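/- Let $\lambda>-\tfrac12$ and $\mu>0$. Let $P_n^{(\alpha,\beta)}$ denote the Jacobi polynomials in the standard normalization $P_n^{(\alpha,\beta)}(1)=\frac{(\alpha+1)_n}{n!}$, that is, $$P_n^{(\alpha,\beta)}(t)=\sum_{k=0}^{n}\frac{(n+\alpha+\beta+1)_k\,(\alpha+k+1)_{n-k}}{k!\,(n-k)!}\Bigl(\frac{t-1}{2}\Bigr)^{k},$$ where $(x)_k=x(x+1)\cdots(x+k-1)$, $(x)_0=1$. For $n=0,1,2,\dots$ define $$\widetilde C_{2n}^{(\lambda,\mu)}(t)=\left(\frac{(2n+\lambda+\mu)\,\Gamma(n+1)\,\Gamma(n+\lambda+\mu)}{\Gamma(n+\lambda+\frac12)\,\Gamma(n+\mu+\frac12)}\right)^{1/2}P_n^{(\lambda-1/2,\,\mu-1/2)}(2t^2-1),$$ $$\widetilde C_{2n+1}^{(\lambda,\mu)}(t)=\left(\frac{(2n+\lambda+\mu+1)\,\Gamma(n+1)\,\Gamma(n+\lambda+\mu+1)}{\Gamma(n+\lambda+\frac12)\,\Gamma(n+\mu+\frac32)}\right)^{1/2}t\,P_n^{(\lambda-1/2,\,\mu+1/2)}(2t^2-1),$$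 where for $n=0$ the product $(\lambda+\mu)\Gamma(\lambda+\mu)$ is read as $\Gamma(\lambda+\mu+1)$. Then these are the orthonormal generalized Gegenbauer polynomials: $\widetilde C_n^{(\lambda,\mu)}$ has degree $n$ and positive leading coefficient, and for all $n,m\ge 0$ $$\int_{-1}^{1}\widetilde C_n^{(\lambda,\mu)}(t)\,\widetilde C_m^{(\lambda,\mu)}(t)\,|t|^{2\mu}(1-t^2)^{\lambda-1/2}\,dt=\begin{cases}1,&n=m,\\0,&n\ne m.\end{cases}$$ Moreover $\|\widetilde C_n^{(\lambda,\mu)}\|_\infty\asymp n^{\max(\lambda,\mu)}$ as $n\to\infty$, where $\|f\|_\infty=\max_{-1\le t\le1}|f(t)|$; that is, there exist positive constants $C_1,C_2$ and a positive integer $n_0$, depending only on $\lambda$ and $\mu$, such that $$C_1\,n^{\max(\lambda,\mu)}\le\bigl\|\widetilde C_n^{(\lambda,\mu)}\bigr\|_\infty\le C_2\,n^{\max(\lambda,\mu)}\qquad\text{for all } n\ge n_0 .$$ -/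

import Mathlib

open Polynomial MeasureTheory

noncomputable section

/-- The Pochhammer symbol `(x)_k = x (x + 1) ⋯ (x + k - 1)`, with `(x)_0 = 1`. -/
def pochhammerSymbol (x : ℝ) (k : ℕ) : ℝ := (ascPochhammer ℝ k).eval x

/-- The Jacobi polynomial in its standard normalization,
`P_n^{(α,β)}(t) = ∑_{k=0}^n (n+α+β+1)_k (α+k+1)_{n-k} / (k! (n-k)!) * ((t-1)/2)^k`.
This is the hypergeometric form `(α+1)_n / n! * ₂F₁(-n, n+α+β+1; α+1; (1-t)/2)`,
cleared of the denominators `(α+1)_k`. -/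
def jacobiPoly (α β : ℝ) (n : ℕ) : ℝ[X] :=
  ∑ k ∈ Finset.range (n + 1),
    C (pochhammerSymbol (n + α + β + 1) k * pochhammerSymbol (α + k + 1) (n - k) /
        ((k.factorial : ℝ) * ((n - k).factorial : ℝ))) *
      (C (1 / 2) * (X - 1)) ^ k

/-- The weight `v_{λ,μ}(t) = |t|^{2μ} (1 - t²)^{λ - 1/2}` on `[-1, 1]`. -/
def gegenbauerWeight (lam mu : ℝ) (t : ℝ) : ℝ :=
  |t| ^ (2 * mu) * (1 - t ^ 2) ^ (lam - 1 / 2)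

/-- The normalizing coefficient of degree `2n`, that is, the square root of
`(2n+λ+μ) Γ(n+1) Γ(n+λ+μ) / (Γ(n+λ+1/2) Γ(n+μ+1/2))`.
For `n = 0` the factor `(λ+μ) Γ(λ+μ)` is read as `Γ(λ+μ+1)`, its value whenever `λ + μ ≠ 0`
and its limit when `λ + μ = 0`. -/
def gegenbauerCoeffEven (lam mu : ℝ) (n : ℕ) : ℝ :=
  if n = 0 then
    √(Real.Gamma (lam + mu + 1) / (Real.Gamma (lam + 1 / 2) * Real.Gamma (mu + 1 / 2)))
  else
    √((2 * n + lam + mu) * Real.Gamma (n + 1) * Real.Gamma (n + lam + mu) /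
      (Real.Gamma (n + lam + 1 / 2) * Real.Gamma (n + mu + 1 / 2)))

/-- The normalizing coefficient of degree `2n + 1`. -/
def gegenbauerCoeffOdd (lam mu : ℝ) (n : ℕ) : ℝ :=
  √((2 * n + lam + mu + 1) * Real.Gamma (n + 1) * Real.Gamma (n + lam + mu + 1) /
    (Real.Gamma (n + lam + 1 / 2) * Real.Gamma (n + mu + 3 / 2)))

/-- The orthonormal generalized Gegenbauer polynomial of degree `n`:
degree `2k` is `ã_{2k} P_k^{(λ-1/2, μ-1/2)}(2t² - 1)` and
degree `2k + 1` is `ã_{2k+1} t P_k^{(λ-1/2, μ+1/2)}(2t² - 1)`. -/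
def orthonormalGegenbauer (lam mu : ℝ) (n : ℕ) : ℝ[X] :=
  if Even n then
    C (gegenbauerCoeffEven lam mu (n / 2)) *
      (jacobiPoly (lam - 1 / 2) (mu - 1 / 2) (n / 2)).comp (2 * X ^ 2 - 1)
  else
    C (gegenbauerCoeffOdd lam mu (n / 2)) * X *
      (jacobiPoly (lam - 1 / 2) (mu + 1 / 2) (n / 2)).comp (2 * X ^ 2 - 1)

/-- `p` is the sequence of orthonormal polynomials on `[-1, 1]` for the weight `w`:
`p n` has degree exactly `n` and positive leading coefficient, and the sequence is orthonormal
in `L²(w)`. (These properties determine `p`.) -/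
structure IsOrthonormalPolySeq (w : ℝ → ℝ) (p : ℕ → ℝ[X]) : Prop where
  degree_eq : ∀ n, (p n).degree = n
  leadingCoeff_pos : ∀ n, 0 < (p n).leadingCoeff
  integrable : ∀ n m, IntegrableOn (fun t => (p n).eval t * (p m).eval t * w t) (Set.Icc (-1) 1)
  integral_eq : ∀ n m,
    ∫ t in Set.Icc (-1 : ℝ) 1, (p n).eval t * (p m).eval t * w t = if n = m then 1 else 0

/-- The uniform norm `max_{-1 ≤ t ≤ 1} |p(t)|` of a polynomial, as the norm of the Banach space
of continuous functions on `[-1, 1]`. -/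
def uniformNorm (p : ℝ[X]) : ℝ := ‖p.toContinuousMapOn (Set.Icc (-1 : ℝ) 1)‖

end

/-! ### Pochhammer symbols -/

/-! The substitution `u = t²` turns the weight into `u^β (1-u)^α` on `[0, 1]` with `α = λ - 1/2`, `β
= μ - 1/2`, and the even-degree polynomials into shifted Jacobi polynomials `p_n(u) = P_n^{(α,β)}(2u
- 1)`. A product of two odd-degree polynomials carries an extra `t² = u`, which raises `β` by one;
mixed products are odd and integrate to zero. Orthogonality follows from the self-adjoint form of
the Jacobi equation. The norms come by induction on `n`, since `p_n'` is a multiple of the Jacobi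
polynomial of degree `n - 1` with both parameters raised; the base case is the Beta integral.

For the sup norm, Gamma asymptotics show that the normalizing coefficients grow like `n^{1/2}` and
that the endpoint values satisfy `p_n(1) ≍ n^α`, `|p_n(0)| ≍ n^β`. The Sonine function `n(n+α+β+1)
p_n² + u(1-u) p_n'²` is largest at an endpoint when `β ≥ -1/2` (`sonine_le_max`). Hence `|p_n| ≲
n^{max(α,β)}`, together with `√(u(1-u)) |p_n'| ≲ n^{max(α,β)+1}`. This settles even degrees, with
lower bounds read off at `t = 1` or `t = 0`.

In odd degree the second Jacobi parameter is `μ + 1/2`, so bounding the Jacobi factor alone loses a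
power of `n` when `μ` dominates; the factor `t` has to recover it. The contiguous relation
`shiftedJacobi_raise` expresses that factor through `p_{n+1}` and `(1-u) p_{n+1}'` at the lower
parameter, and `|t|(1-u) ≤ √(u(1-u))` brings in the weighted derivative bound. Since the polynomial
vanishes at `t = 0`, the lower bound for `λ ≤ μ` is taken at `t = δ/n`
(`exists_le_abs_eval_near_zero`). -/

theorem pochhammerSymbol_zero (x : ℝ) : pochhammerSymbol x 0 = 1 := by
  simp [pochhammerSymbol]

theorem pochhammerSymbol_succ (x : ℝ) (k : ℕ) :
    pochhammerSymbol x (k + 1) = pochhammerSymbol x k * (x + k) := by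
  simp [pochhammerSymbol, ascPochhammer_succ_eval]

theorem pochhammerSymbol_succ_left (x : ℝ) (k : ℕ) :
    pochhammerSymbol x (k + 1) = x * pochhammerSymbol (x + 1) k := by
  simp [pochhammerSymbol, ascPochhammer_succ_left, eval_comp]

theorem pochhammerSymbol_pos {x : ℝ} (hx : 0 < x) (k : ℕ) : 0 < pochhammerSymbol x k :=
  ascPochhammer_pos k x hx

theorem gamma_add_nat {x : ℝ} (hx : 0 < x) (k : ℕ) :
    Real.Gamma (x + k) = pochhammerSymbol x k * Real.Gamma x := by
  induction k with
  | zero => simp [pochhammerSymbol_zero]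
  | succ k ih =>
    have : x + (k + 1 : ℕ) = (x + k) + 1 := by push_cast; ring
    rw [this, Real.Gamma_add_one (by positivity), ih, pochhammerSymbol_succ]
    ring

/-! ### Coefficients of Jacobi polynomials at the endpoint `1` -/

/-- The coefficient of `((t - 1) / 2) ^ k` in the Jacobi polynomial of degree `n`. -/
noncomputable def jacobiCoeff (α β : ℝ) (n k : ℕ) : ℝ :=
  if k ≤ n then
    pochhammerSymbol (n + α + β + 1) k * pochhammerSymbol (α + k + 1) (n - k) /
      ((k.factorial : ℝ) * ((n - k).factorial : ℝ))
  else 0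

theorem jacobiCoeff_add (α β : ℝ) (m k : ℕ) :
    jacobiCoeff α β (k + m) k =
      pochhammerSymbol ((k + m : ℕ) + α + β + 1) k * pochhammerSymbol (α + k + 1) m /
      ((k.factorial : ℝ) * (m.factorial : ℝ)) := by
  simp [jacobiCoeff]

theorem jacobiCoeff_of_lt (α β : ℝ) {n k : ℕ} (h : n < k) : jacobiCoeff α β n k = 0 := by
  simp [jacobiCoeff, h]

/-- The hypergeometric term ratio, equivalent to the Jacobi differential equation. Extending the
coefficients by zero beyond `n` lets this and the next two relations hold for every `k`, so
polynomial identities can be checked coefficientwise. -/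
theorem jacobiCoeff_succ_right (α β : ℝ) (n k : ℕ) :
    ((k : ℝ) + 1) * (k + 1 + α) * jacobiCoeff α β n (k + 1) =
      ((n : ℝ) - k) * (n + k + α + β + 1) * jacobiCoeff α β n k := by
  rcases lt_trichotomy n k with h | rfl | h
  · rw [jacobiCoeff_of_lt _ _ h, jacobiCoeff_of_lt _ _ (by omega)]; ring
  · rw [jacobiCoeff_of_lt _ _ (Nat.lt_succ_self n)]; ring
  · obtain ⟨m, rfl⟩ : ∃ m, n = k + (m + 1) := ⟨n - k - 1, by omega⟩
    have h1 := jacobiCoeff_add α β (m + 1) k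
    have h2 := jacobiCoeff_add α β m (k + 1)
    rw [show k + 1 + m = k + (m + 1) by ring] at h2
    rw [h1, h2, pochhammerSymbol_succ, pochhammerSymbol_succ_left (α + k + 1),
      Nat.factorial_succ, Nat.factorial_succ,
      show α + ((k + 1 : ℕ) : ℝ) + 1 = α + k + 1 + 1 by push_cast; ring]
    push_cast
    field_simp
    ring

theorem jacobiCoeff_derivative (α β : ℝ) (n k : ℕ) :
    ((k : ℝ) + 1) * jacobiCoeff α β (n + 1) (k + 1) =
      (n + α + β + 2) * jacobiCoeff (α + 1) (β + 1) n k := by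
  rcases lt_or_ge n k with h | h
  · rw [jacobiCoeff_of_lt _ _ h, jacobiCoeff_of_lt _ _ (by omega)]; ring
  · obtain ⟨m, rfl⟩ : ∃ m, n = k + m := ⟨n - k, by omega⟩
    have h2 := jacobiCoeff_add α β m (k + 1)
    rw [show k + 1 + m = k + m + 1 by ring] at h2
    rw [jacobiCoeff_add, h2, pochhammerSymbol_succ_left, Nat.factorial_succ,
      show α + ((k + 1 : ℕ) : ℝ) + 1 = α + 1 + k + 1 by push_cast; ring,
      show ((k + m + 1 : ℕ) : ℝ) + α + β + 1 + 1 = (k + m : ℕ) + (α + 1) + (β + 1) + 1 by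
        push_cast; ring]
    push_cast
    field_simp
    ring

theorem jacobiCoeff_raise (α β : ℝ) (n k : ℕ) :
    (n + 1 + α) * jacobiCoeff α (β + 1) n k =
      ((n : ℝ) + 1 - k) * jacobiCoeff α β (n + 1) k := by
  rcases lt_trichotomy (n + 1) k with h | rfl | h
  · rw [jacobiCoeff_of_lt _ _ h, jacobiCoeff_of_lt _ _ (by omega)]; ring
  · rw [jacobiCoeff_of_lt _ _ (Nat.lt_succ_self n)]; push_cast; ring
  · obtain ⟨m, rfl⟩ : ∃ m, n = k + m := ⟨n - k, by omega⟩
    rw [show k + m + 1 = k + (m + 1) by ring, jacobiCoeff_add, jacobiCoeff_add,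
      pochhammerSymbol_succ, Nat.factorial_succ,
      show ((k + m : ℕ) : ℝ) + α + (β + 1) + 1 = (k + (m + 1) : ℕ) + α + β + 1 by
        push_cast; ring]
    push_cast
    field_simp
    ring

theorem jacobiCoeff_zero_right (α β : ℝ) (n : ℕ) :
    jacobiCoeff α β n 0 = pochhammerSymbol (α + 1) n / n.factorial := by
  simp [jacobiCoeff, pochhammerSymbol_zero]

theorem jacobiCoeff_self_pos {α β : ℝ} (hα : -1 < α) (hβ : -1 < β) (n : ℕ) :
    0 < jacobiCoeff α β n n := by
  have h := jacobiCoeff_add α β 0 n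
  rw [add_zero] at h
  rw [h, pochhammerSymbol_zero]
  -- Degree zero is separate because `α + β + 1` need not be positive.
  rcases Nat.eq_zero_or_pos n with rfl | hn
  · simp [pochhammerSymbol_zero]
  · have : (1 : ℝ) ≤ n := by exact_mod_cast hn
    have := pochhammerSymbol_pos (show 0 < (n : ℝ) + α + β + 1 by linarith) n
    positivity

/-! ### Jacobi polynomials transplanted to `[0, 1]` -/

/-- The generating polynomial of `jacobiCoeff α β n`. -/
noncomputable def jacobiAtOne (α β : ℝ) (n : ℕ) : ℝ[X] :=
  ∑ k ∈ Finset.range (n + 1), C (jacobiCoeff α β n k) * X ^ k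

/-- The shifted Jacobi polynomial `u ↦ P_n^{(α,β)}(2u - 1)`. -/
noncomputable def shiftedJacobi (α β : ℝ) (n : ℕ) : ℝ[X] := (jacobiAtOne α β n).comp (X - 1)

theorem coeff_jacobiAtOne (α β : ℝ) (n k : ℕ) :
    (jacobiAtOne α β n).coeff k = jacobiCoeff α β n k := by
  simp only [jacobiAtOne, finsetSum_coeff, coeff_C_mul_X_pow]
  rw [Finset.sum_ite_eq]
  split_ifs with h
  · rfl
  · rw [jacobiCoeff_of_lt]
    simpa [Nat.lt_succ_iff] using h

theorem jacobiPoly_comp_two_mul_X_sq_sub_one (α β : ℝ) (n : ℕ) :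
    (jacobiPoly α β n).comp (2 * X ^ 2 - 1) = (shiftedJacobi α β n).comp (X ^ 2) := by
  have h2 : (C (1 / 2) * (2 * X ^ 2 - 1 - 1) : ℝ[X]) = X ^ 2 - 1 := by
    have : (C (1 / 2) * 2 : ℝ[X]) = 1 := by
      rw [← C_ofNat, ← C_mul]; norm_num
    linear_combination (X ^ 2 - 1) * this
  rw [jacobiPoly, shiftedJacobi, jacobiAtOne, comp_assoc, Polynomial.sum_comp, Polynomial.sum_comp]
  refine Finset.sum_congr rfl fun k hk => ?_
  have hk' : k ≤ n := Nat.lt_succ_iff.mp (Finset.mem_range.mp hk)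
  simp only [mul_comp, C_comp, pow_comp, sub_comp, X_comp, one_comp, h2, jacobiCoeff, if_pos hk']

theorem shiftedJacobi_zero (α β : ℝ) : shiftedJacobi α β 0 = 1 := by
  simp [shiftedJacobi, jacobiAtOne, jacobiCoeff, pochhammerSymbol_zero]

theorem derivative_shiftedJacobi (α β : ℝ) (n : ℕ) :
    derivative (shiftedJacobi α β (n + 1)) =
      C (n + α + β + 2) * shiftedJacobi (α + 1) (β + 1) n := by
  have h : derivative (jacobiAtOne α β (n + 1)) =
      C (n + α + β + 2) * jacobiAtOne (α + 1) (β + 1) n := by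
    ext k
    rw [coeff_derivative, coeff_C_mul, coeff_jacobiAtOne, coeff_jacobiAtOne,
      ← jacobiCoeff_derivative]
    ring
  rw [shiftedJacobi, derivative_comp, h]
  simp [shiftedJacobi]

/-- In powers of `u - 1`, the operator `n + 1 - (u-1) d/du` multiplies the `k`-th coefficient by `n
+ 1 - k`. This kills the top term and lowers the degree. -/
theorem shiftedJacobi_raise (α β : ℝ) (n : ℕ) :
    C (n + 1 + α) * shiftedJacobi α (β + 1) n =
      C ((n : ℝ) + 1) * shiftedJacobi α β (n + 1) -
        (X - 1) * derivative (shiftedJacobi α β (n + 1)) := by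
  have h : C (n + 1 + α) * jacobiAtOne α (β + 1) n =
      C ((n : ℝ) + 1) * jacobiAtOne α β (n + 1) -
        X * derivative (jacobiAtOne α β (n + 1)) := by
    ext k
    rw [coeff_sub, coeff_C_mul, coeff_C_mul, coeff_jacobiAtOne, coeff_jacobiAtOne,
      jacobiCoeff_raise]
    cases k with
    | zero => simp
    | succ k =>
      rw [coeff_X_mul, coeff_derivative, coeff_jacobiAtOne]
      push_cast
      ring
  have := congrArg (fun p => p.comp (X - 1)) h
  simpa [shiftedJacobi, derivative_comp, sub_comp, mul_comp] using this

theorem shiftedJacobi_ode (α β : ℝ) (n : ℕ) :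
    X * (1 - X) * derivative (derivative (shiftedJacobi α β n)) +
      (C (β + 1) - C (α + β + 2) * X) * derivative (shiftedJacobi α β n) +
      C ((n : ℝ) * (n + α + β + 1)) * shiftedJacobi α β n = 0 := by
  have h : X * (X * derivative (derivative (jacobiAtOne α β n))) +
      X * derivative (derivative (jacobiAtOne α β n)) +
      C (α + 1) * derivative (jacobiAtOne α β n) +
      C (α + β + 2) * (X * derivative (jacobiAtOne α β n)) -
      C ((n : ℝ) * (n + α + β + 1)) * jacobiAtOne α β n = 0 := by
    ext k
    have key := jacobiCoeff_succ_right α β n k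
    match k with
    | 0 =>
      simp only [coeff_add, coeff_sub, coeff_C_mul, coeff_X_mul_zero, coeff_derivative,
        coeff_jacobiAtOne, coeff_zero]
      push_cast at key ⊢
      linear_combination key
    | 1 =>
      simp only [coeff_add, coeff_sub, coeff_C_mul, coeff_X_mul_zero, coeff_X_mul,
        coeff_derivative, coeff_jacobiAtOne, coeff_zero]
      push_cast at key ⊢
      linear_combination key
    | k + 2 =>
      simp only [coeff_add, coeff_sub, coeff_C_mul, coeff_X_mul,
        coeff_derivative, coeff_jacobiAtOne, coeff_zero]
      push_cast at key ⊢
      linear_combination key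
  have h1 := congrArg (fun p => p.comp (X - 1)) h
  have h2 : derivative (shiftedJacobi α β n) = (derivative (jacobiAtOne α β n)).comp (X - 1) := by
    simp [shiftedJacobi, derivative_comp]
  have h3 : derivative (derivative (shiftedJacobi α β n)) =
      (derivative (derivative (jacobiAtOne α β n))).comp (X - 1) := by
    rw [h2]; simp [derivative_comp]
  simp only [sub_comp, add_comp, mul_comp, C_comp, X_comp, zero_comp, ← h2, ← h3] at h1
  rw [← shiftedJacobi] at h1
  simp only [C_add, C_ofNat, C_1] at h1 ⊢
  linear_combination -h1

theorem shiftedJacobi_eval_one (α β : ℝ) (n : ℕ) :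
    (shiftedJacobi α β n).eval 1 = pochhammerSymbol (α + 1) n / n.factorial := by
  rw [shiftedJacobi, eval_comp, ← jacobiCoeff_zero_right α β, ← coeff_jacobiAtOne,
    coeff_zero_eq_eval_zero]
  simp

/-- The expansion about `u = 1` does not display the value at `0`. At `u = 0` the differential
equation ties `p'(0)` to `p(0)`, and the contiguous relation then gives a recursion in `n` with `β`
raised by one. -/
theorem shiftedJacobi_eval_zero {α : ℝ} (hα : -1 < α) {β : ℝ} (hβ : -1 < β) (n : ℕ) :
    (shiftedJacobi α β n).eval 0 = (-1) ^ n * (pochhammerSymbol (β + 1) n / n.factorial) := by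
  induction n generalizing β with
  | zero => simp [shiftedJacobi_zero, pochhammerSymbol_zero]
  | succ n ih =>
    have h1 := congrArg (eval 0) (shiftedJacobi_ode α β (n + 1))
    have h2 := congrArg (eval 0) (shiftedJacobi_raise α β n)
    rw [eval_mul, ih (by linarith : -1 < β + 1)] at h2
    simp at h1 h2
    rw [Nat.factorial_succ, pochhammerSymbol_succ_left]
    set p := (shiftedJacobi α β (n + 1)).eval 0
    set d := (derivative (shiftedJacobi α β (n + 1))).eval 0
    have hn : (n : ℝ) + 1 + α ≠ 0 := by
      have : (0 : ℝ) ≤ n := n.cast_nonneg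
      linarith
    have h3 : ((n : ℝ) + 1 + α) * ((β + 1) * ((-1) ^ n *
        (pochhammerSymbol (β + 1 + 1) n / n.factorial))) = (n + 1 + α) * (-(n + 1) * p) := by
      linear_combination (β + 1) * h2 + h1
    have h4 := mul_left_cancel₀ hn h3
    push_cast
    have hf : (n.factorial : ℝ) ≠ 0 := by positivity
    have hn' : (n : ℝ) + 1 ≠ 0 := by positivity
    apply mul_left_cancel₀ hn'
    rw [pow_succ]
    field_simp at h4 ⊢
    linear_combination h4

theorem natDegree_shiftedJacobi {α β : ℝ} (hα : -1 < α) (hβ : -1 < β) (n : ℕ) :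
    (shiftedJacobi α β n).natDegree = n ∧ 0 < (shiftedJacobi α β n).leadingCoeff := by
  have hpos := jacobiCoeff_self_pos hα hβ n
  have h1 : (jacobiAtOne α β n).natDegree = n := by
    apply natDegree_eq_of_le_of_coeff_ne_zero
    · refine natDegree_le_iff_coeff_eq_zero.mpr fun k hk => ?_
      rw [coeff_jacobiAtOne, jacobiCoeff_of_lt _ _ hk]
    · rw [coeff_jacobiAtOne]; exact hpos.ne'
  have h2 : (X - 1 : ℝ[X]).natDegree = 1 := natDegree_X_sub_C (1 : ℝ)
  have h3 : (X - 1 : ℝ[X]).leadingCoeff = 1 := leadingCoeff_X_sub_C (1 : ℝ)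
  constructor
  · rw [shiftedJacobi, natDegree_comp, h1, h2, mul_one]
  · rw [shiftedJacobi, leadingCoeff_comp (by omega), h3, one_pow, mul_one, leadingCoeff, h1,
      coeff_jacobiAtOne]
    exact hpos

/-! ### The Jacobi weight on `[0, 1]` -/

/-- The Jacobi weight `u ^ β (1 - u) ^ α` on `[0, 1]`. -/
noncomputable def shiftedJacobiWeight (α β u : ℝ) : ℝ := u ^ β * (1 - u) ^ α

theorem intervalIntegrable_shiftedJacobiWeight {α β : ℝ} (hα : -1 < α) (hβ : -1 < β) :
    IntervalIntegrable (shiftedJacobiWeight α β) volume 0 1 := by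
  have h := Complex.betaIntegral_convergent (u := (β + 1 : ℝ)) (v := (α + 1 : ℝ))
    (by simpa using by linarith) (by simpa using by linarith)
  rw [intervalIntegrable_iff_integrableOn_Ioo_of_le zero_le_one] at h ⊢
  refine (h.re).congr ?_
  refine (ae_restrict_iff' measurableSet_Ioo).mpr (Filter.Eventually.of_forall fun u hu => ?_)
  have h1 : (u : ℂ) ^ (((β + 1 : ℝ) : ℂ) - 1) = ((u ^ β : ℝ) : ℂ) := by
    rw [Complex.ofReal_cpow hu.1.le]; simp
  have h2 : (1 - (u : ℂ)) ^ (((α + 1 : ℝ) : ℂ) - 1) = (((1 - u) ^ α : ℝ) : ℂ) := by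
    rw [Complex.ofReal_cpow (by linarith [hu.2])]; simp
  simp only [h1, h2, ← Complex.ofReal_mul]
  simp [shiftedJacobiWeight]

theorem integral_shiftedJacobiWeight {α β : ℝ} (hα : -1 < α) (hβ : -1 < β) :
    ∫ u in (0 : ℝ)..1, shiftedJacobiWeight α β u =
      Real.Gamma (α + 1) * Real.Gamma (β + 1) / Real.Gamma (α + β + 2) := by
  have h := ProbabilityTheory.beta_eq_betaIntegralReal (β + 1) (α + 1) (by linarith) (by linarith)
  rw [ProbabilityTheory.beta, show β + 1 + (α + 1) = α + β + 2 by ring] at h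
  rw [mul_comm, h, Complex.betaIntegral]
  rw [← Complex.reCLM_apply, ← ContinuousLinearMap.intervalIntegral_comp_comm]
  · rw [intervalIntegral.integral_of_le zero_le_one, intervalIntegral.integral_of_le zero_le_one,
      integral_Ioc_eq_integral_Ioo, integral_Ioc_eq_integral_Ioo]
    refine setIntegral_congr_fun measurableSet_Ioo fun u hu => ?_
    have h1 : (u : ℂ) ^ (((β + 1 : ℝ) : ℂ) - 1) = ((u ^ β : ℝ) : ℂ) := by
      rw [Complex.ofReal_cpow hu.1.le]; simp
    have h2 : (1 - (u : ℂ)) ^ (((α + 1 : ℝ) : ℂ) - 1) = (((1 - u) ^ α : ℝ) : ℂ) := by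
      rw [Complex.ofReal_cpow (by linarith [hu.2])]; simp
    simp only [h1, h2, ← Complex.ofReal_mul, Complex.reCLM_apply, Complex.ofReal_re]
    rfl
  · exact Complex.betaIntegral_convergent (by simpa using by linarith) (by simpa using by linarith)

theorem intervalIntegrable_shiftedJacobiWeight_mul {α β : ℝ} (hα : -1 < α) (hβ : -1 < β)
    (p : ℝ[X]) :
    IntervalIntegrable (fun u => shiftedJacobiWeight α β u * p.eval u) volume 0 1 :=
  (intervalIntegrable_shiftedJacobiWeight hα hβ).mul_continuousOn p.continuous.continuousOn

/-- Integration by parts for the Jacobi differential operator. -/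
theorem integral_derivative_mul_derivative {α β : ℝ} (hα : -1 < α) (hβ : -1 < β) (n : ℕ)
    (q : ℝ[X]) :
    ∫ u in (0 : ℝ)..1, shiftedJacobiWeight (α + 1) (β + 1) u *
        (derivative (shiftedJacobi α β n) * derivative q).eval u =
      n * (n + α + β + 1) *
        ∫ u in (0 : ℝ)..1, shiftedJacobiWeight α β u * (shiftedJacobi α β n * q).eval u := by
  set p := shiftedJacobi α β n with hp
  have hcont : ContinuousOn (fun u => shiftedJacobiWeight (α + 1) (β + 1) u *
      (derivative p * q).eval u) (Set.Icc 0 1) := by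
    unfold shiftedJacobiWeight
    refine ContinuousOn.mul (Continuous.continuousOn ?_) (Polynomial.continuous _).continuousOn
    exact (Real.continuous_rpow_const (by linarith)).mul
      ((Real.continuous_rpow_const (by linarith)).comp (by fun_prop))
  have hderiv : ∀ u ∈ Set.Ioo (0 : ℝ) 1, HasDerivAt
      (fun u => shiftedJacobiWeight (α + 1) (β + 1) u * (derivative p * q).eval u)
      (shiftedJacobiWeight (α + 1) (β + 1) u * (derivative p * derivative q).eval u -
        n * (n + α + β + 1) * (shiftedJacobiWeight α β u * (p * q).eval u)) u := by
    intro u hu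
    have h1 : HasDerivAt (fun u : ℝ => u ^ (β + 1)) ((β + 1) * u ^ β) u := by
      simpa using Real.hasDerivAt_rpow_const (x := u) (p := β + 1) (Or.inl hu.1.ne')
    have h2 : HasDerivAt (fun u : ℝ => (1 - u) ^ (α + 1)) ((-1 + -α) * (1 - u) ^ α) u := by
      have := ((hasDerivAt_id u).const_sub 1).rpow_const (p := α + 1)
        (Or.inl (by simpa using by linarith [hu.2]))
      simpa using this
    have h3 := (h1.mul h2).mul ((derivative p * q).hasDerivAt u)
    have hode := congrArg (eval u) (shiftedJacobi_ode α β n)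
    rw [← hp] at hode
    have hw1 : u ^ (β + 1) = u ^ β * u := Real.rpow_add_one hu.1.ne' _
    have hw2 : (1 - u) ^ (α + 1) = (1 - u) ^ α * (1 - u) :=
      Real.rpow_add_one (by linarith [hu.2]) _
    -- The two sides differ by the Jacobi equation multiplied by `u^β (1-u)^α q(u)`.
    refine h3.congr_deriv ?_
    simp at hode
    simp only [shiftedJacobiWeight, Pi.mul_apply, derivative_mul, eval_mul, eval_add, hw1, hw2]
    linear_combination (u ^ β * (1 - u) ^ α * eval u q) * hode
  have hi1 := intervalIntegrable_shiftedJacobiWeight_mul (show -1 < α + 1 by linarith)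
    (show -1 < β + 1 by linarith) (derivative p * derivative q)
  have hi2 := (intervalIntegrable_shiftedJacobiWeight_mul hα hβ (p * q)).const_mul
    ((n : ℝ) * (n + α + β + 1))
  have key := intervalIntegral.integral_eq_sub_of_hasDerivAt_of_le zero_le_one hcont hderiv
    (hi1.sub hi2)
  rw [intervalIntegral.integral_sub hi1 hi2, intervalIntegral.integral_const_mul] at key
  -- The boundary terms vanish because `α + 1` and `β + 1` are positive.
  have e0 : shiftedJacobiWeight (α + 1) (β + 1) 0 = 0 := by
    rw [shiftedJacobiWeight, Real.zero_rpow (by linarith), zero_mul]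
  have e1 : shiftedJacobiWeight (α + 1) (β + 1) 1 = 0 := by
    rw [shiftedJacobiWeight, sub_self, Real.zero_rpow (by linarith), mul_zero]
  simp only [e0, e1, zero_mul, sub_zero] at key
  linarith

/-- The Dirichlet form on the left of the integration by parts is symmetric, so eigenfunctions with
distinct eigenvalues are orthogonal. -/
theorem integral_shiftedJacobi_mul_of_ne {α β : ℝ} (hα : -1 < α) (hβ : -1 < β) {n m : ℕ}
    (h : n ≠ m) :
    ∫ u in (0 : ℝ)..1, shiftedJacobiWeight α β u *
      (shiftedJacobi α β n * shiftedJacobi α β m).eval u = 0 := by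
  have h1 := integral_derivative_mul_derivative hα hβ n (shiftedJacobi α β m)
  have h2 := integral_derivative_mul_derivative hα hβ m (shiftedJacobi α β n)
  rw [mul_comm (derivative _), mul_comm (shiftedJacobi α β m), h1] at h2
  -- This is the difference of the eigenvalues; the second factor is positive since `n + m ≥ 1` and
  -- `α + β > -2`.
  have h3 : ((n : ℝ) - m) * (n + m + α + β + 1) ≠ 0 := by
    have hnm : (n : ℝ) ≠ m := by exact_mod_cast h
    have : (1 : ℝ) ≤ n + m := by
      have : 1 ≤ n + m := by omega
      exact_mod_cast this
    exact mul_ne_zero (sub_ne_zero.mpr hnm) (by linarith)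
  apply mul_left_cancel₀ h3
  linear_combination h2

/-- The exceptional case `n = 0`, `α + β + 1 = 0` is excluded because there `Real.Gamma 0 = 0` and
the zero linear factor make the left side vanish. It never arises in the induction, where lowering
`n` raises `α` and `β`. -/
theorem integral_shiftedJacobi_mul_self {α β : ℝ} (hα : -1 < α) (hβ : -1 < β) (n : ℕ)
    (h : n = 0 → α + β + 1 ≠ 0) :
    (∫ u in (0 : ℝ)..1, shiftedJacobiWeight α β u *
      (shiftedJacobi α β n * shiftedJacobi α β n).eval u) *
      ((2 * n + α + β + 1) * n.factorial * Real.Gamma (n + α + β + 1)) =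
    Real.Gamma (n + α + 1) * Real.Gamma (n + β + 1) := by
  induction n generalizing α β with
  | zero =>
    have h0 := h rfl
    have hg : 0 < Real.Gamma (α + β + 2) := Real.Gamma_pos_of_pos (by linarith)
    simp only [shiftedJacobi_zero, mul_one, eval_one, integral_shiftedJacobiWeight hα hβ]
    have : Real.Gamma (α + β + 2) = (α + β + 1) * Real.Gamma (α + β + 1) := by
      rw [← Real.Gamma_add_one h0]; ring_nf
    simp only [Nat.cast_zero, mul_zero, zero_add, Nat.factorial_zero, Nat.cast_one, mul_one,
      ← this]
    field_simp
  | succ n ih =>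
    have hn : (0 : ℝ) ≤ n := n.cast_nonneg
    have ih' := ih (α := α + 1) (β := β + 1) (by linarith) (by linarith)
      (fun _ => by linarith)
    have h1 := integral_derivative_mul_derivative hα hβ (n + 1) (shiftedJacobi α β (n + 1))
    rw [derivative_shiftedJacobi] at h1
    set J := ∫ u in (0 : ℝ)..1, shiftedJacobiWeight α β u *
      (shiftedJacobi α β (n + 1) * shiftedJacobi α β (n + 1)).eval u
    set I := ∫ u in (0 : ℝ)..1, shiftedJacobiWeight (α + 1) (β + 1) u *
      (shiftedJacobi (α + 1) (β + 1) n * shiftedJacobi (α + 1) (β + 1) n).eval u with hI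
    have h2 : ∫ u in (0 : ℝ)..1, shiftedJacobiWeight (α + 1) (β + 1) u *
        (C (n + α + β + 2) * shiftedJacobi (α + 1) (β + 1) n *
          (C (n + α + β + 2) * shiftedJacobi (α + 1) (β + 1) n)).eval u =
        (n + α + β + 2) ^ 2 * I := by
      rw [hI, ← intervalIntegral.integral_const_mul]
      congr 1
      ext u
      simp only [eval_mul, eval_C]
      ring
    rw [h2] at h1
    have hc : (n : ℝ) + α + β + 2 ≠ 0 := by linarith
    -- Integration by parts with `q = p` relates the norm to that of the derivative; one eigenvalue
    -- factor cancels against the squared constant in `p'`.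
    have h3 : (n + α + β + 2) * I = (n + 1) * J := by
      apply mul_left_cancel₀ hc
      push_cast at h1
      linear_combination h1
    have hG : Real.Gamma (n + (α + 1) + (β + 1) + 1) =
        (n + α + β + 2) * Real.Gamma ((n + 1 : ℕ) + α + β + 1) := by
      rw [show (n : ℝ) + (α + 1) + (β + 1) + 1 = (n + α + β + 2) + 1 by ring,
        Real.Gamma_add_one hc]
      push_cast; ring_nf
    rw [hG] at ih'
    rw [Nat.factorial_succ, show ((n + 1 : ℕ) : ℝ) + α + 1 = n + (α + 1) + 1 by push_cast; ring,
      show ((n + 1 : ℕ) : ℝ) + β + 1 = n + (β + 1) + 1 by push_cast; ring, ← ih']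
    generalize Real.Gamma ((n + 1 : ℕ) + α + β + 1) = G
    push_cast
    linear_combination -((2 * n + α + β + 3) * n.factorial * G) * h3

/-! ### Quadratic substitution -/

theorem image_sq_Ioo : (fun t : ℝ => t ^ 2) '' Set.Ioo 0 1 = Set.Ioo 0 1 := by
  ext u
  constructor
  · rintro ⟨t, ht, rfl⟩
    exact ⟨pow_pos ht.1 2, by dsimp only; nlinarith [ht.1, ht.2]⟩
  · intro hu
    refine ⟨√u, ⟨Real.sqrt_pos.mpr hu.1, ?_⟩, Real.sq_sqrt hu.1.le⟩
    rw [Real.sqrt_lt' one_pos]; simpa using hu.2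

theorem integral_Ioo_comp_sq (f : ℝ → ℝ) :
    ∫ u in Set.Ioo (0 : ℝ) 1, f u = ∫ t in Set.Ioo (0 : ℝ) 1, 2 * t * f (t ^ 2) := by
  have hinj : Set.InjOn (fun t : ℝ => t ^ 2) (Set.Ioo 0 1) := fun a ha b hb h =>
    (pow_left_inj₀ ha.1.le hb.1.le two_ne_zero).mp h
  have := integral_image_eq_integral_abs_deriv_smul (measurableSet_Ioo (a := (0 : ℝ)) (b := 1))
    (f := fun t => t ^ 2) (f' := fun t => 2 * t)
    (fun t _ => by simpa using (hasDerivAt_pow 2 t).hasDerivWithinAt) hinj f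
  rw [image_sq_Ioo] at this
  rw [this]
  refine setIntegral_congr_fun measurableSet_Ioo fun t ht => ?_
  simp [abs_of_pos ht.1]

theorem integrableOn_Ioo_comp_sq {f : ℝ → ℝ} (hf : IntegrableOn f (Set.Ioo 0 1)) :
    IntegrableOn (fun t : ℝ => 2 * t * f (t ^ 2)) (Set.Ioo 0 1) := by
  have hinj : Set.InjOn (fun t : ℝ => t ^ 2) (Set.Ioo 0 1) := fun a ha b hb h =>
    (pow_left_inj₀ ha.1.le hb.1.le two_ne_zero).mp h
  have := integrableOn_image_iff_integrableOn_abs_deriv_smul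
    (measurableSet_Ioo (a := (0 : ℝ)) (b := 1))
    (f := fun t => t ^ 2) (f' := fun t => 2 * t)
    (fun t _ => by simpa using (hasDerivAt_pow 2 t).hasDerivWithinAt) hinj f
  rw [image_sq_Ioo] at this
  refine (this.mp hf).congr_fun (fun t ht => ?_) measurableSet_Ioo
  simp [abs_of_pos ht.1]

/-! ### The generalized Gegenbauer weight -/

theorem gegenbauerWeight_neg (lam mu t : ℝ) :
    gegenbauerWeight lam mu (-t) = gegenbauerWeight lam mu t := by
  simp [gegenbauerWeight]

/-- With the Jacobian `2t` of `u = t²`, `t · t^{2β} = t^{2μ}` forces `β = μ - 1/2`. -/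
theorem two_mul_gegenbauerWeight (lam mu : ℝ) {t : ℝ} (ht : 0 < t) :
    2 * t * shiftedJacobiWeight (lam - 1 / 2) (mu - 1 / 2) (t ^ 2) =
      2 * gegenbauerWeight lam mu t := by
  have h : t ^ (2 * mu) = t * (t ^ 2) ^ (mu - 1 / 2) := by
    rw [← Real.rpow_natCast t 2, ← Real.rpow_mul ht.le]
    nth_rewrite 2 [← Real.rpow_one t]
    rw [← Real.rpow_add ht]
    congr 1; push_cast; ring
  rw [gegenbauerWeight, shiftedJacobiWeight, abs_of_pos ht, h]
  ring

theorem intervalIntegrable_mul_gegenbauerWeight {lam mu : ℝ} (hlam : -(1 / 2) < lam)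
    (hmu : 0 < mu) (p : ℝ[X]) :
    IntervalIntegrable (fun t => p.eval t * gegenbauerWeight lam mu t) volume 0 1 ∧
    IntervalIntegrable (fun t => p.eval t * gegenbauerWeight lam mu t) volume (-1) 0 := by
  have h : IntervalIntegrable (gegenbauerWeight lam mu) volume 0 1 := by
    have h := intervalIntegrable_shiftedJacobiWeight (α := lam - 1 / 2) (β := mu - 1 / 2)
      (by linarith) (by linarith)
    rw [intervalIntegrable_iff_integrableOn_Ioo_of_le zero_le_one] at h ⊢
    refine IntegrableOn.congr_fun ((integrableOn_Ioo_comp_sq h).const_mul (1 / 2))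
      (fun t ht => ?_) measurableSet_Ioo
    simp only [two_mul_gegenbauerWeight lam mu ht.1]
    ring
  have h' : IntervalIntegrable (gegenbauerWeight lam mu) volume (-1) 0 := by
    rw [IntervalIntegrable.iff_comp_neg]
    simpa [gegenbauerWeight_neg] using h.symm
  exact ⟨h.continuousOn_mul p.continuous.continuousOn,
    h'.continuousOn_mul p.continuous.continuousOn⟩

theorem integrableOn_mul_gegenbauerWeight {lam mu : ℝ} (hlam : -(1 / 2) < lam)
    (hmu : 0 < mu) (p : ℝ[X]) :
    IntegrableOn (fun t => p.eval t * gegenbauerWeight lam mu t) (Set.Icc (-1) 1) := by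
  obtain ⟨h1, h2⟩ := intervalIntegrable_mul_gegenbauerWeight hlam hmu p
  rw [← intervalIntegrable_iff_integrableOn_Icc_of_le (by norm_num)]
  exact h2.trans h1

theorem integral_mul_gegenbauerWeight {lam mu : ℝ} (hlam : -(1 / 2) < lam)
    (hmu : 0 < mu) (p : ℝ[X]) :
    ∫ t in Set.Icc (-1 : ℝ) 1, p.eval t * gegenbauerWeight lam mu t =
      ∫ t in (0 : ℝ)..1, (p.eval t + p.eval (-t)) * gegenbauerWeight lam mu t := by
  obtain ⟨h1, h2⟩ := intervalIntegrable_mul_gegenbauerWeight hlam hmu p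
  have h3 : IntervalIntegrable (fun t => p.eval (-t) * gegenbauerWeight lam mu t) volume 0 1 := by
    rw [IntervalIntegrable.iff_comp_neg]
    simpa [gegenbauerWeight_neg] using h2.symm
  rw [integral_Icc_eq_integral_Ioc, ← intervalIntegral.integral_of_le (by norm_num),
    ← intervalIntegral.integral_add_adjacent_intervals h2 h1]
  have h4 : ∫ t in (-1 : ℝ)..0, p.eval t * gegenbauerWeight lam mu t =
      ∫ t in (0 : ℝ)..1, p.eval (-t) * gegenbauerWeight lam mu t := by
    have := intervalIntegral.integral_comp_neg (a := (0 : ℝ)) (b := 1)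
      (fun t => p.eval t * gegenbauerWeight lam mu t)
    simpa [gegenbauerWeight_neg] using this.symm
  rw [h4, ← intervalIntegral.integral_add h3 h1]
  congr 1
  ext t
  ring

theorem integral_comp_sq_mul_gegenbauerWeight {lam mu : ℝ} (hlam : -(1 / 2) < lam)
    (hmu : 0 < mu) (q : ℝ[X]) :
    ∫ t in Set.Icc (-1 : ℝ) 1, (q.comp (X ^ 2)).eval t * gegenbauerWeight lam mu t =
      ∫ u in (0 : ℝ)..1, shiftedJacobiWeight (lam - 1 / 2) (mu - 1 / 2) u * q.eval u := by
  rw [integral_mul_gegenbauerWeight hlam hmu, intervalIntegral.integral_of_le zero_le_one,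
    intervalIntegral.integral_of_le zero_le_one, integral_Ioc_eq_integral_Ioo,
    integral_Ioc_eq_integral_Ioo,
    integral_Ioo_comp_sq (fun u => shiftedJacobiWeight (lam - 1 / 2) (mu - 1 / 2) u * q.eval u)]
  refine setIntegral_congr_fun measurableSet_Ioo fun t ht => ?_
  have := two_mul_gegenbauerWeight lam mu ht.1
  simp only [eval_comp, eval_pow, eval_X, neg_sq]
  linear_combination -(q.eval (t ^ 2)) * this

theorem integral_X_mul_comp_sq_mul_gegenbauerWeight {lam mu : ℝ} (hlam : -(1 / 2) < lam)
    (hmu : 0 < mu) (q : ℝ[X]) :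
    ∫ t in Set.Icc (-1 : ℝ) 1, (X * q.comp (X ^ 2)).eval t * gegenbauerWeight lam mu t = 0 := by
  rw [integral_mul_gegenbauerWeight hlam hmu]
  simp [eval_comp]

/-! ### Orthonormality -/

theorem orthonormalGegenbauer_even (lam mu : ℝ) (k : ℕ) :
    orthonormalGegenbauer lam mu (2 * k) = C (gegenbauerCoeffEven lam mu k) *
      (shiftedJacobi (lam - 1 / 2) (mu - 1 / 2) k).comp (X ^ 2) := by
  rw [orthonormalGegenbauer, if_pos (even_two_mul k), Nat.mul_div_cancel_left k two_pos,
    jacobiPoly_comp_two_mul_X_sq_sub_one]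

theorem orthonormalGegenbauer_odd (lam mu : ℝ) (k : ℕ) :
    orthonormalGegenbauer lam mu (2 * k + 1) = C (gegenbauerCoeffOdd lam mu k) *
      (X * (shiftedJacobi (lam - 1 / 2) (mu + 1 / 2) k).comp (X ^ 2)) := by
  rw [orthonormalGegenbauer, if_neg (by simp),
    show (2 * k + 1) / 2 = k by omega, jacobiPoly_comp_two_mul_X_sq_sub_one, mul_assoc]

theorem gegenbauerCoeffEven_pos {lam mu : ℝ} (hlam : -(1 / 2) < lam) (hmu : 0 < mu) (k : ℕ) :
    0 < gegenbauerCoeffEven lam mu k := by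
  have hk : (0 : ℝ) ≤ k := k.cast_nonneg
  have h1 := Real.Gamma_pos_of_pos (show 0 < (k : ℝ) + lam + 1 / 2 by linarith)
  have h2 := Real.Gamma_pos_of_pos (show 0 < (k : ℝ) + mu + 1 / 2 by linarith)
  rw [gegenbauerCoeffEven]
  split_ifs with h
  · subst h
    simp only [Nat.cast_zero, zero_add] at h1 h2
    have h3 := Real.Gamma_pos_of_pos (show 0 < lam + mu + 1 by linarith)
    positivity
  · have hk : (1 : ℝ) ≤ k := by exact_mod_cast Nat.one_le_iff_ne_zero.mpr h
    have h3 := Real.Gamma_pos_of_pos (show 0 < (k : ℝ) + lam + mu by linarith)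
    have h4 := Real.Gamma_pos_of_pos (show 0 < (k : ℝ) + 1 by linarith)
    have h5 : 0 < 2 * (k : ℝ) + lam + mu := by linarith
    positivity

theorem gegenbauerCoeffOdd_pos {lam mu : ℝ} (hlam : -(1 / 2) < lam) (hmu : 0 < mu) (k : ℕ) :
    0 < gegenbauerCoeffOdd lam mu k := by
  have hk : (0 : ℝ) ≤ k := k.cast_nonneg
  have h1 := Real.Gamma_pos_of_pos (show 0 < (k : ℝ) + lam + 1 / 2 by linarith)
  have h2 := Real.Gamma_pos_of_pos (show 0 < (k : ℝ) + mu + 3 / 2 by linarith)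
  have h3 := Real.Gamma_pos_of_pos (show 0 < (k : ℝ) + lam + mu + 1 by linarith)
  have h4 := Real.Gamma_pos_of_pos (show 0 < (k : ℝ) + 1 by linarith)
  have h5 : 0 < 2 * (k : ℝ) + lam + mu + 1 := by linarith
  rw [gegenbauerCoeffOdd]
  positivity

theorem gegenbauerCoeffEven_sq_mul_integral {lam mu : ℝ} (hlam : -(1 / 2) < lam) (hmu : 0 < mu)
    (k : ℕ) :
    gegenbauerCoeffEven lam mu k ^ 2 *
      ∫ u in (0 : ℝ)..1, shiftedJacobiWeight (lam - 1 / 2) (mu - 1 / 2) u *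
        (shiftedJacobi (lam - 1 / 2) (mu - 1 / 2) k *
          shiftedJacobi (lam - 1 / 2) (mu - 1 / 2) k).eval u = 1 := by
  have hpos := gegenbauerCoeffEven_pos hlam hmu k
  have hk : (0 : ℝ) ≤ k := k.cast_nonneg
  have h1 := Real.Gamma_pos_of_pos (show 0 < (k : ℝ) + lam + 1 / 2 by linarith)
  have h2 := Real.Gamma_pos_of_pos (show 0 < (k : ℝ) + mu + 1 / 2 by linarith)
  rw [gegenbauerCoeffEven] at hpos ⊢
  split_ifs at hpos ⊢ with h
  · subst h
    simp only [Nat.cast_zero, zero_add] at h1 h2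
    rw [Real.sq_sqrt (Real.sqrt_pos.mp hpos).le]
    simp only [shiftedJacobi_zero, mul_one, eval_one]
    rw [integral_shiftedJacobiWeight (by linarith) (by linarith),
      show lam - 1 / 2 + 1 = lam + 1 / 2 by ring, show mu - 1 / 2 + 1 = mu + 1 / 2 by ring,
      show lam - 1 / 2 + (mu - 1 / 2) + 2 = lam + mu + 1 by ring]
    have h3 := Real.Gamma_pos_of_pos (show 0 < lam + mu + 1 by linarith)
    rw [div_mul_div_comm, mul_comm, div_self (by positivity)]
  · have key := integral_shiftedJacobi_mul_self (α := lam - 1 / 2) (β := mu - 1 / 2)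
      (by linarith) (by linarith) k (fun h' => absurd h' h)
    rw [Real.sq_sqrt (Real.sqrt_pos.mp hpos).le, Real.Gamma_nat_eq_factorial]
    rw [show (k : ℝ) + (lam - 1 / 2) + 1 = k + lam + 1 / 2 by ring,
      show (k : ℝ) + (mu - 1 / 2) + 1 = k + mu + 1 / 2 by ring,
      show (k : ℝ) + (lam - 1 / 2) + (mu - 1 / 2) + 1 = k + lam + mu by ring,
      show 2 * (k : ℝ) + (lam - 1 / 2) + (mu - 1 / 2) + 1 = 2 * k + lam + mu by ring] at key
    rw [div_mul_eq_mul_div, div_eq_one_iff_eq (by positivity)]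
    linear_combination key

theorem gegenbauerCoeffOdd_sq_mul_integral {lam mu : ℝ} (hlam : -(1 / 2) < lam) (hmu : 0 < mu)
    (k : ℕ) :
    gegenbauerCoeffOdd lam mu k ^ 2 *
      ∫ u in (0 : ℝ)..1, shiftedJacobiWeight (lam - 1 / 2) (mu + 1 / 2) u *
        (shiftedJacobi (lam - 1 / 2) (mu + 1 / 2) k *
          shiftedJacobi (lam - 1 / 2) (mu + 1 / 2) k).eval u = 1 := by
  have hpos := gegenbauerCoeffOdd_pos hlam hmu k
  have hk : (0 : ℝ) ≤ k := k.cast_nonneg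
  have h1 := Real.Gamma_pos_of_pos (show 0 < (k : ℝ) + lam + 1 / 2 by linarith)
  have h2 := Real.Gamma_pos_of_pos (show 0 < (k : ℝ) + mu + 3 / 2 by linarith)
  rw [gegenbauerCoeffOdd] at hpos ⊢
  have key := integral_shiftedJacobi_mul_self (α := lam - 1 / 2) (β := mu + 1 / 2)
    (by linarith) (by linarith) k (fun _ => by linarith)
  rw [Real.sq_sqrt (Real.sqrt_pos.mp hpos).le, Real.Gamma_nat_eq_factorial]
  rw [show (k : ℝ) + (lam - 1 / 2) + 1 = k + lam + 1 / 2 by ring,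
    show (k : ℝ) + (mu + 1 / 2) + 1 = k + mu + 3 / 2 by ring,
    show (k : ℝ) + (lam - 1 / 2) + (mu + 1 / 2) + 1 = k + lam + mu + 1 by ring,
    show 2 * (k : ℝ) + (lam - 1 / 2) + (mu + 1 / 2) + 1 = 2 * k + lam + mu + 1 by ring] at key
  rw [div_mul_eq_mul_div, div_eq_one_iff_eq (by positivity)]
  linear_combination key

theorem integral_orthonormalGegenbauer {lam mu : ℝ} (hlam : -(1 / 2) < lam) (hmu : 0 < mu)
    (n m : ℕ) :
    ∫ t in Set.Icc (-1 : ℝ) 1, (orthonormalGegenbauer lam mu n *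
      orthonormalGegenbauer lam mu m).eval t * gegenbauerWeight lam mu t =
      if n = m then 1 else 0 := by
  rcases Nat.even_or_odd' n with ⟨k, rfl | rfl⟩ <;> rcases Nat.even_or_odd' m with ⟨l, rfl | rfl⟩
  · rw [orthonormalGegenbauer_even, orthonormalGegenbauer_even]
    set p := shiftedJacobi (lam - 1 / 2) (mu - 1 / 2) with hp
    set a := gegenbauerCoeffEven lam mu with ha
    rw [show C (a k) * (p k).comp (X ^ 2) * (C (a l) * (p l).comp (X ^ 2)) =
        (C (a k * a l) * (p k * p l)).comp (X ^ 2) by simp [mul_comp]; ring,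
      integral_comp_sq_mul_gegenbauerWeight hlam hmu]
    simp only [eval_C_mul, mul_left_comm _ (a k * a l)]
    rw [intervalIntegral.integral_const_mul]
    by_cases h : k = l
    · subst h
      rw [if_pos rfl, ← sq]
      exact gegenbauerCoeffEven_sq_mul_integral hlam hmu k
    · rw [if_neg (by omega), hp,
        integral_shiftedJacobi_mul_of_ne (by linarith) (by linarith) h, mul_zero]
  · rw [orthonormalGegenbauer_even, orthonormalGegenbauer_odd, if_neg (by omega)]
    set p := shiftedJacobi (lam - 1 / 2) (mu - 1 / 2)
    set q := shiftedJacobi (lam - 1 / 2) (mu + 1 / 2)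
    set a := gegenbauerCoeffEven lam mu k
    set b := gegenbauerCoeffOdd lam mu l
    rw [show C a * (p k).comp (X ^ 2) * (C b * (X * (q l).comp (X ^ 2))) =
        X * (C (a * b) * (p k * q l)).comp (X ^ 2) by simp [mul_comp]; ring,
      integral_X_mul_comp_sq_mul_gegenbauerWeight hlam hmu]
  · rw [orthonormalGegenbauer_even, orthonormalGegenbauer_odd, if_neg (by omega)]
    set p := shiftedJacobi (lam - 1 / 2) (mu - 1 / 2)
    set q := shiftedJacobi (lam - 1 / 2) (mu + 1 / 2)
    set a := gegenbauerCoeffEven lam mu l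
    set b := gegenbauerCoeffOdd lam mu k
    rw [show C b * (X * (q k).comp (X ^ 2)) * (C a * (p l).comp (X ^ 2)) =
        X * (C (a * b) * (p l * q k)).comp (X ^ 2) by simp [mul_comp]; ring,
      integral_X_mul_comp_sq_mul_gegenbauerWeight hlam hmu]
  · rw [orthonormalGegenbauer_odd, orthonormalGegenbauer_odd]
    set p := shiftedJacobi (lam - 1 / 2) (mu + 1 / 2) with hp
    set a := gegenbauerCoeffOdd lam mu with ha
    rw [show C (a k) * (X * (p k).comp (X ^ 2)) * (C (a l) * (X * (p l).comp (X ^ 2))) =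
        (C (a k * a l) * (X * (p k * p l))).comp (X ^ 2) by simp [mul_comp]; ring,
      integral_comp_sq_mul_gegenbauerWeight hlam hmu]
    simp only [eval_C_mul, mul_left_comm _ (a k * a l)]
    -- The factor `u` coming from `t · t` is absorbed into the weight.
    have hw : ∫ u in (0 : ℝ)..1, shiftedJacobiWeight (lam - 1 / 2) (mu - 1 / 2) u *
          (X * (p k * p l)).eval u =
        ∫ u in (0 : ℝ)..1, shiftedJacobiWeight (lam - 1 / 2) (mu + 1 / 2) u *
          (p k * p l).eval u := by
      rw [intervalIntegral.integral_of_le zero_le_one, intervalIntegral.integral_of_le zero_le_one,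
        integral_Ioc_eq_integral_Ioo, integral_Ioc_eq_integral_Ioo]
      refine setIntegral_congr_fun measurableSet_Ioo fun u hu => ?_
      have : u ^ (mu + 1 / 2) = u ^ (mu - 1 / 2) * u := by
        rw [← Real.rpow_add_one hu.1.ne']; ring_nf
      simp only [shiftedJacobiWeight, this, eval_mul, eval_X]
      ring
    rw [intervalIntegral.integral_const_mul, hw]
    by_cases h : k = l
    · subst h
      rw [if_pos rfl, ← sq]
      exact gegenbauerCoeffOdd_sq_mul_integral hlam hmu k
    · rw [if_neg (by omega), hp,
        integral_shiftedJacobi_mul_of_ne (by linarith) (by linarith) h, mul_zero]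

theorem natDegree_orthonormalGegenbauer {lam mu : ℝ} (hlam : -(1 / 2) < lam) (hmu : 0 < mu)
    (n : ℕ) :
    (orthonormalGegenbauer lam mu n).natDegree = n ∧
      0 < (orthonormalGegenbauer lam mu n).leadingCoeff := by
  rcases Nat.even_or_odd' n with ⟨k, rfl | rfl⟩
  · obtain ⟨h1, h2⟩ := natDegree_shiftedJacobi (α := lam - 1 / 2) (β := mu - 1 / 2)
      (by linarith) (by linarith) k
    have ha := gegenbauerCoeffEven_pos hlam hmu k
    rw [orthonormalGegenbauer_even]
    constructor
    · rw [natDegree_C_mul ha.ne', natDegree_comp, h1, natDegree_X_pow, mul_comm]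
    · rw [leadingCoeff_mul, leadingCoeff_C, leadingCoeff_comp (by simp), leadingCoeff_X_pow,
        one_pow, mul_one]
      positivity
  · obtain ⟨h1, h2⟩ := natDegree_shiftedJacobi (α := lam - 1 / 2) (β := mu + 1 / 2)
      (by linarith) (by linarith) k
    have ha := gegenbauerCoeffOdd_pos hlam hmu k
    have h0 : (shiftedJacobi (lam - 1 / 2) (mu + 1 / 2) k).comp (X ^ 2) ≠ 0 := by
      rw [← leadingCoeff_ne_zero, leadingCoeff_comp (by simp), leadingCoeff_X_pow,
        one_pow, mul_one]
      exact h2.ne'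
    rw [orthonormalGegenbauer_odd]
    constructor
    · rw [natDegree_C_mul ha.ne', natDegree_X_mul h0, natDegree_comp, h1, natDegree_X_pow,
        mul_comm]
    · rw [leadingCoeff_mul, leadingCoeff_mul, leadingCoeff_X, leadingCoeff_C,
        leadingCoeff_comp (by simp), leadingCoeff_X_pow, one_pow, mul_one, one_mul]
      positivity

theorem isOrthonormalPolySeq_orthonormalGegenbauer {lam mu : ℝ} (hlam : -(1 / 2) < lam)
    (hmu : 0 < mu) :
    IsOrthonormalPolySeq (gegenbauerWeight lam mu) (orthonormalGegenbauer lam mu) where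
  degree_eq n := by
    obtain ⟨h1, h2⟩ := natDegree_orthonormalGegenbauer hlam hmu n
    rw [degree_eq_natDegree (leadingCoeff_ne_zero.mp h2.ne'), h1]
  leadingCoeff_pos n := (natDegree_orthonormalGegenbauer hlam hmu n).2
  integrable n m := by
    simpa only [eval_mul] using integrableOn_mul_gegenbauerWeight hlam hmu
      (orthonormalGegenbauer lam mu n * orthonormalGegenbauer lam mu m)
  integral_eq n m := by
    simpa only [eval_mul] using integral_orthonormalGegenbauer hlam hmu n m

/-! ### The Sonine function -/

/-- The Sonine function `n(n+α+β+1) p² + u(1-u) p'²` of the shifted Jacobi polynomial `p`. -/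
noncomputable def sonine (α β : ℝ) (n : ℕ) : ℝ[X] :=
  C ((n : ℝ) * (n + α + β + 1)) * shiftedJacobi α β n ^ 2 +
    X * (1 - X) * derivative (shiftedJacobi α β n) ^ 2

/-- Twice `p'` times the Jacobi equation eliminates `p''` and the product `p p'`, leaving `p'²`
times an affine function. -/
theorem derivative_sonine (α β : ℝ) (n : ℕ) :
    derivative (sonine α β n) = derivative (shiftedJacobi α β n) ^ 2 *
      (C (2 * α + 1) + C (2 * (α + β + 1)) * (X - 1)) := by
  have h := shiftedJacobi_ode α β n
  rw [sonine]
  simp only [derivative_add, derivative_mul, derivative_C, derivative_pow, derivative_X,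
    derivative_sub, derivative_one, C_add, C_mul, C_ofNat, C_1] at h ⊢
  simp only [Nat.cast_ofNat, Nat.add_one_sub_one, C_ofNat]
  linear_combination (2 * derivative (shiftedJacobi α β n)) * h

/-- The affine factor of the derivative equals `-(2β + 1) ≤ 0` at `0`. It can therefore only change
sign from negative to positive, and the Sonine function has no interior maximum exceeding both
endpoint values. -/
theorem sonine_le_max {β : ℝ} (hβ : -(1 / 2) ≤ β) (α : ℝ) (n : ℕ) {u : ℝ}
    (hu : u ∈ Set.Icc (0 : ℝ) 1) :
    (sonine α β n).eval u ≤ max ((sonine α β n).eval 0) ((sonine α β n).eval 1) := by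
  have hd (v : ℝ) : deriv (fun v => (sonine α β n).eval v) v =
      (derivative (shiftedJacobi α β n)).eval v ^ 2 *
        ((2 * α + 1) + 2 * (α + β + 1) * (v - 1)) := by
    rw [Polynomial.deriv, derivative_sonine]
    simp
  obtain ⟨h0, h1⟩ := hu
  by_cases hL : (2 * α + 1) + 2 * (α + β + 1) * (u - 1) ≤ 0
  · refine le_max_of_le_left ?_
    refine antitoneOn_of_deriv_nonpos (convex_Icc 0 u) (sonine α β n).continuous.continuousOn
      (sonine α β n).differentiable.differentiableOn (fun v hv => ?_)
      (Set.left_mem_Icc.mpr h0) (Set.right_mem_Icc.mpr h0) h0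
    rw [interior_Icc] at hv
    rw [hd]
    refine mul_nonpos_of_nonneg_of_nonpos (sq_nonneg _) ?_
    by_contra! hv'
    nlinarith [hv.1, hv.2]
  · refine le_max_of_le_right ?_
    push Not at hL
    refine monotoneOn_of_deriv_nonneg (convex_Icc u 1) (sonine α β n).continuous.continuousOn
      (sonine α β n).differentiable.differentiableOn (fun v hv => ?_)
      (Set.left_mem_Icc.mpr h1) (Set.right_mem_Icc.mpr h1) h1
    rw [interior_Icc] at hv
    rw [hd]
    refine mul_nonneg (sq_nonneg _) ?_
    have : 0 < α + β + 1 := by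
      by_contra! h
      nlinarith
    nlinarith [hv.1, hv.2]

/-- At the endpoints the `p'²` term disappears, so `B` controls the Sonine function everywhere, and
each of its two nonnegative terms separately. -/
theorem sonine_bound {α β : ℝ} (hα : -1 < α) (hβ : -(1 / 2) ≤ β) {n : ℕ} (hn : n ≠ 0) {B : ℝ}
    (h0 : |(shiftedJacobi α β n).eval 0| ≤ B) (h1 : |(shiftedJacobi α β n).eval 1| ≤ B)
    {u : ℝ} (hu : u ∈ Set.Icc (0 : ℝ) 1) :
    |(shiftedJacobi α β n).eval u| ≤ B ∧
      u * (1 - u) * (derivative (shiftedJacobi α β n)).eval u ^ 2 ≤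
        n * (n + α + β + 1) * B ^ 2 := by
  have hn' : (1 : ℝ) ≤ n := by exact_mod_cast Nat.one_le_iff_ne_zero.mpr hn
  have hL : 0 < (n : ℝ) * (n + α + β + 1) := mul_pos (by linarith) (by linarith)
  have h := sonine_le_max hβ α n hu
  have hB : 0 ≤ B := (abs_nonneg _).trans h0
  have h2 : (sonine α β n).eval u ≤ n * (n + α + β + 1) * B ^ 2 := by
    refine h.trans (max_le ?_ ?_)
    · have : (shiftedJacobi α β n).eval 0 ^ 2 ≤ B ^ 2 := sq_le_sq' (abs_le.mp h0).1 (abs_le.mp h0).2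
      simpa [sonine] using mul_le_mul_of_nonneg_left this hL.le
    · have : (shiftedJacobi α β n).eval 1 ^ 2 ≤ B ^ 2 := sq_le_sq' (abs_le.mp h1).1 (abs_le.mp h1).2
      simpa [sonine] using mul_le_mul_of_nonneg_left this hL.le
  have h3 : 0 ≤ u * (1 - u) * (derivative (shiftedJacobi α β n)).eval u ^ 2 :=
    mul_nonneg (mul_nonneg hu.1 (by linarith [hu.2])) (sq_nonneg _)
  have h4 : (sonine α β n).eval u = n * (n + α + β + 1) * (shiftedJacobi α β n).eval u ^ 2 +
      u * (1 - u) * (derivative (shiftedJacobi α β n)).eval u ^ 2 := by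
    simp [sonine]
  constructor
  · refine abs_le_of_sq_le_sq ?_ hB
    exact le_of_mul_le_mul_left (by linarith) hL
  · nlinarith [sq_nonneg ((shiftedJacobi α β n).eval u)]

/-! ### Asymptotics of Gamma quotients -/

open Filter Asymptotics Topology

theorem Asymptotics.IsTheta.congr' {ι : Type*} {l : Filter ι} {f₁ f₂ g₁ g₂ : ι → ℝ}
    (h : f₁ =Θ[l] g₁) (hf : f₁ =ᶠ[l] f₂) (hg : g₁ =ᶠ[l] g₂) : f₂ =Θ[l] g₂ :=
  ⟨h.1.congr' hf hg, h.2.congr' hg hf⟩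

/-- Euler's limit formula: `Γ(n+s+1) = Γ(s) · n! n^s / GammaSeq s n`, and the denominator tends to
`Γ(s) > 0`. -/
theorem gamma_nat_add_add_one_isTheta {s : ℝ} (hs : 0 < s) :
    (fun n : ℕ => Real.Gamma (n + (s + 1))) =Θ[atTop]
      fun n : ℕ => (n.factorial : ℝ) * (n : ℝ) ^ s := by
  have hprod (n : ℕ) : ∏ j ∈ Finset.range n, (s + j) = pochhammerSymbol s n := by
    induction n with
    | zero => simp [pochhammerSymbol_zero]
    | succ n ih => rw [Finset.prod_range_succ, ih, pochhammerSymbol_succ]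
  have hG := Real.Gamma_pos_of_pos hs
  have h1 : (fun n : ℕ => Real.GammaSeq s n) =Θ[atTop] fun _ => (1 : ℝ) :=
    ((isEquivalent_const_iff_tendsto hG.ne').mpr (Real.GammaSeq_tendsto_Gamma s)).isTheta.trans
      (isTheta_const_const hG.ne' one_ne_zero)
  have h2 : (fun n : ℕ => (n.factorial : ℝ) * (n : ℝ) ^ s * (Real.GammaSeq s n)⁻¹) =Θ[atTop]
      fun n : ℕ => (n.factorial : ℝ) * (n : ℝ) ^ s := by
    simpa using (isTheta_refl (fun n : ℕ => (n.factorial : ℝ) * (n : ℝ) ^ s) atTop).mul h1.inv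
  refine (IsTheta.const_mul_left hG.ne' h2).congr' ?_ EventuallyEq.rfl
  filter_upwards [eventually_ge_atTop 1] with n hn
  have hn' : (0 : ℝ) < n := by exact_mod_cast hn
  have hp := pochhammerSymbol_pos hs (n + 1)
  have hr := Real.rpow_pos_of_pos hn' s
  rw [Real.GammaSeq, hprod, show (n : ℝ) + (s + 1) = s + (n + 1 : ℕ) by push_cast; ring,
    gamma_add_nat hs]
  field_simp

theorem gamma_nat_add_isTheta_of_succ {s : ℝ}
    (h : (fun n : ℕ => Real.Gamma (n + (s + 1))) =Θ[atTop]
      fun n : ℕ => (n.factorial : ℝ) * (n : ℝ) ^ s) :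
    (fun n : ℕ => Real.Gamma (n + s)) =Θ[atTop]
      fun n : ℕ => (n.factorial : ℝ) * (n : ℝ) ^ (s - 1) := by
  have h1 : (fun n : ℕ => (n : ℝ) + s) =Θ[atTop] fun n : ℕ => (n : ℝ) := by
    refine (isTheta_refl (fun n : ℕ => (n : ℝ)) atTop).add_isLittleO ?_
    exact isLittleO_const_left.mpr (Or.inr
      (tendsto_norm_atTop_atTop.comp tendsto_natCast_atTop_atTop))
  refine (h.div h1).congr' ?_ ?_
  · filter_upwards [tendsto_natCast_atTop_atTop.eventually_gt_atTop (-s)] with n hn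
    have : (n : ℝ) + s ≠ 0 := by linarith
    rw [← add_assoc, Real.Gamma_add_one this]
    field_simp
  · filter_upwards [eventually_ge_atTop 1] with n hn
    have hn' : (n : ℝ) ≠ 0 := by positivity
    rw [Real.rpow_sub_one hn', mul_div_assoc]

/-- Two downward steps of the functional equation extend the range to `s > -1`, which is needed
because `λ + μ` may be negative. -/
theorem gamma_nat_add_isTheta {s : ℝ} (hs : -1 < s) :
    (fun n : ℕ => Real.Gamma (n + s)) =Θ[atTop]
      fun n : ℕ => (n.factorial : ℝ) * (n : ℝ) ^ (s - 1) := by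
  refine gamma_nat_add_isTheta_of_succ ?_
  have := gamma_nat_add_isTheta_of_succ (s := s + 1)
    (gamma_nat_add_add_one_isTheta (by linarith))
  simpa using this

theorem pochhammerSymbol_div_factorial_isTheta {α : ℝ} (hα : -1 < α) :
    (fun n : ℕ => pochhammerSymbol (α + 1) n / n.factorial) =Θ[atTop]
      fun n : ℕ => (n : ℝ) ^ α := by
  have hG := Real.Gamma_pos_of_pos (show 0 < α + 1 by linarith)
  have h := (gamma_nat_add_isTheta (s := α + 1) (by linarith)).div
    (isTheta_refl (fun n : ℕ => (n.factorial : ℝ)) atTop)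
  refine (IsTheta.const_mul_left (inv_ne_zero hG.ne') h).congr' ?_ ?_
  · filter_upwards with n
    rw [add_comm (n : ℝ), gamma_add_nat (by linarith)]
    field_simp
  · filter_upwards with n
    have : (n.factorial : ℝ) ≠ 0 := by positivity
    rw [add_sub_cancel_right]
    field_simp

theorem linear_nat_isTheta (c : ℝ) :
    (fun n : ℕ => 2 * (n : ℝ) + c) =Θ[atTop] fun n : ℕ => (n : ℝ) := by
  refine (IsTheta.const_mul_left two_ne_zero
    (isTheta_refl (fun n : ℕ => (n : ℝ)) atTop)).add_isLittleO ?_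
  exact isLittleO_const_left.mpr (Or.inr
    (tendsto_norm_atTop_atTop.comp tendsto_natCast_atTop_atTop))

theorem exists_bounds_of_isTheta {f g : ℕ → ℝ} (h : f =Θ[atTop] g)
    (hf : ∀ n, 0 ≤ f n) (hg : ∀ n, 0 ≤ g n) :
    ∃ c C : ℝ, 0 < c ∧ 0 < C ∧ ∀ᶠ n in atTop, c * g n ≤ f n ∧ f n ≤ C * g n := by
  obtain ⟨C, hC, h1⟩ := h.1.exists_pos
  obtain ⟨D, hD, h2⟩ := h.2.exists_pos
  refine ⟨D⁻¹, C, inv_pos.mpr hD, hC, ?_⟩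
  filter_upwards [h1.bound, h2.bound] with n h1 h2
  rw [Real.norm_of_nonneg (hf n), Real.norm_of_nonneg (hg n)] at h1 h2
  exact ⟨(inv_mul_le_iff₀ hD).mpr h2, h1⟩

theorem isTheta_of_sq {f g : ℕ → ℝ} (h : (fun n => f n ^ 2) =Θ[atTop] fun n => g n ^ 2) :
    f =Θ[atTop] g :=
  ⟨IsBigO.of_pow two_ne_zero h.1, IsBigO.of_pow two_ne_zero h.2⟩

/-- The factorials cancel, and `a + 1 = b + d` leaves exactly the linear factor. -/
theorem gamma_quotient_isTheta {a b c d : ℝ} (ha : -1 < a) (hb : -1 < b) (hd : -1 < d)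
    (h : a + 1 = b + d) :
    (fun n : ℕ => (2 * (n : ℝ) + c) * Real.Gamma (n + 1) * Real.Gamma (n + a) /
      (Real.Gamma (n + b) * Real.Gamma (n + d))) =Θ[atTop] fun n : ℕ => (n : ℝ) := by
  refine ((((linear_nat_isTheta c).mul (gamma_nat_add_isTheta (s := 1) (by norm_num))).mul
    (gamma_nat_add_isTheta ha)).div
      ((gamma_nat_add_isTheta hb).mul (gamma_nat_add_isTheta hd))).congr' EventuallyEq.rfl ?_
  filter_upwards [eventually_ge_atTop 1] with n hn
  have hn' : (0 : ℝ) < n := by exact_mod_cast hn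
  have h1 := Real.rpow_pos_of_pos hn' (b - 1)
  have h2 := Real.rpow_pos_of_pos hn' (d - 1)
  rw [sub_self, Real.rpow_zero, show a - 1 = (b - 1) + (d - 1) by linarith, Real.rpow_add hn']
  field_simp

theorem gegenbauerCoeffEven_isTheta {lam mu : ℝ} (hlam : -(1 / 2) < lam) (hmu : 0 < mu) :
    gegenbauerCoeffEven lam mu =Θ[atTop] fun n : ℕ => (n : ℝ) ^ (1 / 2 : ℝ) := by
  refine isTheta_of_sq ?_
  refine (gamma_quotient_isTheta (a := lam + mu) (b := lam + 1 / 2) (c := lam + mu)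
    (d := mu + 1 / 2) (by linarith) (by linarith) (by linarith) (by ring)).congr' ?_ ?_
  · filter_upwards [eventually_ge_atTop 1] with n hn
    have hpos := gegenbauerCoeffEven_pos hlam hmu n
    rw [gegenbauerCoeffEven, if_neg (by omega)] at hpos ⊢
    rw [Real.sq_sqrt (Real.sqrt_pos.mp hpos).le]
    simp only [add_assoc]
  · filter_upwards with n
    rw [← Real.sqrt_eq_rpow, Real.sq_sqrt n.cast_nonneg]

theorem gegenbauerCoeffOdd_isTheta {lam mu : ℝ} (hlam : -(1 / 2) < lam) (hmu : 0 < mu) :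
    gegenbauerCoeffOdd lam mu =Θ[atTop] fun n : ℕ => (n : ℝ) ^ (1 / 2 : ℝ) := by
  refine isTheta_of_sq ?_
  refine (gamma_quotient_isTheta (a := lam + mu + 1) (b := lam + 1 / 2) (c := lam + mu + 1)
    (d := mu + 3 / 2) (by linarith) (by linarith) (by linarith) (by ring)).congr' ?_ ?_
  · filter_upwards with n
    have hpos := gegenbauerCoeffOdd_pos hlam hmu n
    rw [gegenbauerCoeffOdd] at hpos ⊢
    rw [Real.sq_sqrt (Real.sqrt_pos.mp hpos).le]
    simp only [add_assoc]
  · filter_upwards with n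
    rw [← Real.sqrt_eq_rpow, Real.sq_sqrt n.cast_nonneg]

/-! ### Uniform bounds for shifted Jacobi polynomials -/

theorem pochhammerSymbol_div_factorial_nonneg {α : ℝ} (hα : -1 < α) (n : ℕ) :
    0 ≤ pochhammerSymbol (α + 1) n / n.factorial := by
  have := pochhammerSymbol_pos (show 0 < α + 1 by linarith) n
  positivity

theorem exists_pochhammerSymbol_div_factorial_bounds {α : ℝ} (hα : -1 < α) :
    ∃ c C : ℝ, 0 < c ∧ 0 < C ∧ ∀ᶠ n : ℕ in atTop,
      c * (n : ℝ) ^ α ≤ pochhammerSymbol (α + 1) n / n.factorial ∧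
        pochhammerSymbol (α + 1) n / n.factorial ≤ C * (n : ℝ) ^ α :=
  exists_bounds_of_isTheta (pochhammerSymbol_div_factorial_isTheta hα)
    (pochhammerSymbol_div_factorial_nonneg hα) fun n => by positivity

theorem abs_shiftedJacobi_eval_zero {α β : ℝ} (hα : -1 < α) (hβ : -1 < β) (n : ℕ) :
    |(shiftedJacobi α β n).eval 0| = pochhammerSymbol (β + 1) n / n.factorial := by
  rw [shiftedJacobi_eval_zero hα hβ, abs_mul, abs_neg_one_pow, one_mul,
    abs_of_nonneg (pochhammerSymbol_div_factorial_nonneg hβ n)]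

theorem exists_shiftedJacobi_bound {α β : ℝ} (hα : -1 < α) (hβ : -(1 / 2) ≤ β) :
    ∃ C : ℝ, 0 < C ∧ ∀ᶠ n : ℕ in atTop, ∀ u ∈ Set.Icc (0 : ℝ) 1,
      |(shiftedJacobi α β n).eval u| ≤ C * (n : ℝ) ^ max α β ∧
      √(u * (1 - u)) * |(derivative (shiftedJacobi α β n)).eval u| ≤
        C * (n : ℝ) ^ (max α β + 1) := by
  obtain ⟨_, C₁, _, hC₁, h1⟩ := exists_pochhammerSymbol_div_factorial_bounds hα
  obtain ⟨_, C₂, _, hC₂, h2⟩ := exists_pochhammerSymbol_div_factorial_bounds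
    (show -1 < β by linarith)
  -- Chosen so that the eigenvalue satisfies `n(n+α+β+1) ≤ (K n)²`.
  set K := 1 + |α + β + 1| with hK
  have hK1 : 1 ≤ K := by have := abs_nonneg (α + β + 1); linarith
  refine ⟨K * (C₁ + C₂), by positivity, ?_⟩
  filter_upwards [h1, h2, eventually_ge_atTop 1] with n h1 h2 hn u hu
  have hn' : (1 : ℝ) ≤ n := by exact_mod_cast hn
  have hα' : (n : ℝ) ^ α ≤ (n : ℝ) ^ max α β :=
    Real.rpow_le_rpow_of_exponent_le hn' (le_max_left _ _)
  have hβ' : (n : ℝ) ^ β ≤ (n : ℝ) ^ max α β :=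
    Real.rpow_le_rpow_of_exponent_le hn' (le_max_right _ _)
  set R := (n : ℝ) ^ max α β with hR
  have hR0 : 0 ≤ R := by positivity
  have hb0 : |(shiftedJacobi α β n).eval 0| ≤ (C₁ + C₂) * R := by
    rw [abs_shiftedJacobi_eval_zero hα (by linarith)]
    nlinarith [h2.2]
  have hb1 : |(shiftedJacobi α β n).eval 1| ≤ (C₁ + C₂) * R := by
    rw [shiftedJacobi_eval_one, abs_of_nonneg (pochhammerSymbol_div_factorial_nonneg hα n)]
    nlinarith [h1.2]
  obtain ⟨h3, h4⟩ := sonine_bound hα hβ (by omega) hb0 hb1 hu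
  have hD : 0 ≤ (C₁ + C₂) * R := by positivity
  constructor
  · refine h3.trans ?_
    rw [mul_assoc]
    exact le_mul_of_one_le_left hD hK1
  · rw [Real.rpow_add_one (by linarith), ← hR]
    have h5 : (n : ℝ) * (n + α + β + 1) ≤ (K * n) ^ 2 := by
      have : α + β + 1 ≤ |α + β + 1| := le_abs_self _
      have h6 : (n : ℝ) + α + β + 1 ≤ K * n := by nlinarith [abs_nonneg (α + β + 1)]
      have h7 : K * (n : ℝ) ^ 2 ≤ K ^ 2 * (n : ℝ) ^ 2 := by
        apply mul_le_mul_of_nonneg_right _ (sq_nonneg _)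
        nlinarith
      nlinarith
    have h8 : u * (1 - u) * (derivative (shiftedJacobi α β n)).eval u ^ 2 ≤
        (K * n * ((C₁ + C₂) * R)) ^ 2 := by
      rw [mul_pow (K * n)]
      exact h4.trans (mul_le_mul_of_nonneg_right h5 (sq_nonneg _))
    have h9 := Real.sqrt_le_sqrt h8
    rw [Real.sqrt_sq (by positivity), Real.sqrt_mul (mul_nonneg hu.1 (by linarith [hu.2])),
      Real.sqrt_sq_eq_abs] at h9
    linarith

/-- The derivative is `O(n)` times a Jacobi polynomial with raised parameters. Unlike the Sonine
estimate, this does not degenerate at the endpoints, at the cost of one more power of `n`. -/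
theorem exists_derivative_shiftedJacobi_bound {α β : ℝ} (hα : -1 < α) (hβ : -1 < β) :
    ∃ C : ℝ, 0 < C ∧ ∀ᶠ n : ℕ in atTop, ∀ u ∈ Set.Icc (0 : ℝ) 1,
      |(derivative (shiftedJacobi α β n)).eval u| ≤ C * (n : ℝ) ^ (max α β + 2) := by
  obtain ⟨C, hC, h⟩ := exists_shiftedJacobi_bound (α := α + 1) (β := β + 1) (by linarith)
    (by linarith)
  set K := 2 + |α + β| with hK
  refine ⟨K * C, by positivity, ?_⟩
  filter_upwards [(tendsto_sub_atTop_nat 1).eventually h, eventually_ge_atTop 1] with n h hn u hu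
  obtain ⟨j, rfl⟩ : ∃ j, n = j + 1 := ⟨n - 1, by omega⟩
  have h1 := (h u hu).1
  rw [Nat.add_sub_cancel, max_add_add_right] at h1
  have hM : -1 < max α β := lt_max_of_lt_left hα
  have hj : (0 : ℝ) ≤ j := j.cast_nonneg
  have h2 : (j : ℝ) ^ (max α β + 1) ≤ ((j + 1 : ℕ) : ℝ) ^ (max α β + 1) :=
    Real.rpow_le_rpow hj (by push_cast; linarith) (by linarith)
  have hc : |(j : ℝ) + α + β + 2| ≤ K * (j + 1 : ℕ) := by
    push_cast
    rw [abs_le]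
    have := abs_nonneg (α + β)
    have h3 := neg_abs_le (α + β)
    have h4 := le_abs_self (α + β)
    constructor <;> nlinarith
  rw [derivative_shiftedJacobi, eval_C_mul, abs_mul,
    show max α β + 2 = max α β + 1 + 1 by ring, Real.rpow_add_one (by positivity)]
  calc _ ≤ K * (j + 1 : ℕ) * (C * ((j + 1 : ℕ) : ℝ) ^ (max α β + 1)) := by
        refine mul_le_mul hc (h1.trans ?_) (abs_nonneg _) (by positivity)
        exact mul_le_mul_of_nonneg_left h2 hC.le
    _ = _ := by ring

/-! ### The uniform norm -/

theorem abs_eval_le_uniformNorm (p : ℝ[X]) {t : ℝ} (ht : t ∈ Set.Icc (-1 : ℝ) 1) :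
    |p.eval t| ≤ uniformNorm p :=
  (p.toContinuousMapOn (Set.Icc (-1 : ℝ) 1)).norm_coe_le_norm ⟨t, ht⟩

theorem uniformNorm_le {p : ℝ[X]} {B : ℝ} (hB : 0 ≤ B)
    (h : ∀ t ∈ Set.Icc (-1 : ℝ) 1, |p.eval t| ≤ B) : uniformNorm p ≤ B :=
  (ContinuousMap.norm_le _ hB).mpr fun t => h t t.2

theorem sq_mem_Icc {t : ℝ} (ht : t ∈ Set.Icc (-1 : ℝ) 1) : t ^ 2 ∈ Set.Icc (0 : ℝ) 1 :=
  ⟨sq_nonneg t, by nlinarith [ht.1, ht.2]⟩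

theorem abs_eval_orthonormalGegenbauer_even {lam mu : ℝ} (hlam : -(1 / 2) < lam) (hmu : 0 < mu)
    (k : ℕ) (t : ℝ) :
    |(orthonormalGegenbauer lam mu (2 * k)).eval t| = gegenbauerCoeffEven lam mu k *
      |(shiftedJacobi (lam - 1 / 2) (mu - 1 / 2) k).eval (t ^ 2)| := by
  rw [orthonormalGegenbauer_even, eval_C_mul, abs_mul,
    abs_of_pos (gegenbauerCoeffEven_pos hlam hmu k)]
  simp [eval_comp]

theorem abs_eval_orthonormalGegenbauer_odd {lam mu : ℝ} (hlam : -(1 / 2) < lam) (hmu : 0 < mu)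
    (k : ℕ) (t : ℝ) :
    |(orthonormalGegenbauer lam mu (2 * k + 1)).eval t| = gegenbauerCoeffOdd lam mu k *
      (|t| * |(shiftedJacobi (lam - 1 / 2) (mu + 1 / 2) k).eval (t ^ 2)|) := by
  rw [orthonormalGegenbauer_odd, eval_C_mul, abs_mul,
    abs_of_pos (gegenbauerCoeffOdd_pos hlam hmu k)]
  simp [eval_comp, abs_mul]

theorem exists_gegenbauerCoeffEven_bounds {lam mu : ℝ} (hlam : -(1 / 2) < lam) (hmu : 0 < mu) :
    ∃ c C : ℝ, 0 < c ∧ 0 < C ∧ ∀ᶠ n : ℕ in atTop,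
      c * (n : ℝ) ^ (1 / 2 : ℝ) ≤ gegenbauerCoeffEven lam mu n ∧
        gegenbauerCoeffEven lam mu n ≤ C * (n : ℝ) ^ (1 / 2 : ℝ) :=
  exists_bounds_of_isTheta (gegenbauerCoeffEven_isTheta hlam hmu)
    (fun n => (gegenbauerCoeffEven_pos hlam hmu n).le) fun n => by positivity

theorem exists_gegenbauerCoeffOdd_bounds {lam mu : ℝ} (hlam : -(1 / 2) < lam) (hmu : 0 < mu) :
    ∃ c C : ℝ, 0 < c ∧ 0 < C ∧ ∀ᶠ n : ℕ in atTop,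
      c * (n : ℝ) ^ (1 / 2 : ℝ) ≤ gegenbauerCoeffOdd lam mu n ∧
        gegenbauerCoeffOdd lam mu n ≤ C * (n : ℝ) ^ (1 / 2 : ℝ) :=
  exists_bounds_of_isTheta (gegenbauerCoeffOdd_isTheta hlam hmu)
    (fun n => (gegenbauerCoeffOdd_pos hlam hmu n).le) fun n => by positivity

theorem exists_uniformNorm_even_le {lam mu : ℝ} (hlam : -(1 / 2) < lam) (hmu : 0 < mu) :
    ∃ C : ℝ, 0 < C ∧ ∀ᶠ k : ℕ in atTop,
      uniformNorm (orthonormalGegenbauer lam mu (2 * k)) ≤ C * (k : ℝ) ^ max lam mu := by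
  obtain ⟨_, C₁, _, hC₁, h1⟩ := exists_gegenbauerCoeffEven_bounds hlam hmu
  obtain ⟨C₂, hC₂, h2⟩ := exists_shiftedJacobi_bound (α := lam - 1 / 2) (β := mu - 1 / 2)
    (by linarith) (by linarith)
  refine ⟨C₁ * C₂, by positivity, ?_⟩
  filter_upwards [h1, h2, eventually_ge_atTop 1] with k h1 h2 hk
  have hk' : (0 : ℝ) < k := by exact_mod_cast hk
  refine uniformNorm_le (by positivity) fun t ht => ?_
  rw [abs_eval_orthonormalGegenbauer_even hlam hmu]
  have h3 := (h2 _ (sq_mem_Icc ht)).1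
  rw [max_sub_sub_right] at h3
  calc _ ≤ C₁ * (k : ℝ) ^ (1 / 2 : ℝ) * (C₂ * (k : ℝ) ^ (max lam mu - 1 / 2)) :=
        mul_le_mul h1.2 h3 (abs_nonneg _) (by positivity)
    _ = C₁ * C₂ * ((k : ℝ) ^ (1 / 2 : ℝ) * (k : ℝ) ^ (max lam mu - 1 / 2)) := by ring
    _ = _ := by rw [← Real.rpow_add hk']; ring_nf

theorem exists_uniformNorm_odd_le {lam mu : ℝ} (hlam : -(1 / 2) < lam) (hmu : 0 < mu) :
    ∃ C : ℝ, 0 < C ∧ ∀ᶠ k : ℕ in atTop,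
      uniformNorm (orthonormalGegenbauer lam mu (2 * k + 1)) ≤ C * (k : ℝ) ^ max lam mu := by
  obtain ⟨_, C₁, _, hC₁, h1⟩ := exists_gegenbauerCoeffOdd_bounds hlam hmu
  obtain ⟨C₂, hC₂, h2⟩ := exists_shiftedJacobi_bound (α := lam - 1 / 2) (β := mu - 1 / 2)
    (by linarith) (by linarith)
  set M := max lam mu with hM
  have hM0 : 0 < M := lt_max_of_lt_right hmu
  -- A factor `2` comes from the two terms of the contiguous relation, another from `k + 1/2 + λ ≥
  -- k/2`, and the power of `2` from `k + 1 ≤ 2k`.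
  refine ⟨C₁ * (4 * C₂ * 2 ^ (M + 1 / 2)), by positivity, ?_⟩
  filter_upwards [h1, (tendsto_add_atTop_nat 1).eventually h2, eventually_ge_atTop 1]
    with k h1 h2 hk
  have hk' : (1 : ℝ) ≤ k := by exact_mod_cast hk
  have hk0 : (0 : ℝ) < k := by linarith
  refine uniformNorm_le (by positivity) fun t ht => ?_
  rw [abs_eval_orthonormalGegenbauer_odd hlam hmu]
  set u := t ^ 2 with hu
  have hu01 : u ∈ Set.Icc (0 : ℝ) 1 := sq_mem_Icc ht
  have ht1 : |t| ≤ 1 := abs_le.mpr ht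
  have ht0 := abs_nonneg t
  obtain ⟨h3, h4⟩ := h2 u hu01
  rw [max_sub_sub_right, ← hM] at h3 h4
  have hR : ((k + 1 : ℕ) : ℝ) ^ (M - 1 / 2 + 1) =
      ((k + 1 : ℕ) : ℝ) ^ (M - 1 / 2) * (k + 1) := by
    rw [Real.rpow_add_one (by positivity)]; push_cast; ring
  set R := ((k + 1 : ℕ) : ℝ) ^ (M - 1 / 2 + 1) with hRdef
  set r := ((k + 1 : ℕ) : ℝ) ^ (M - 1 / 2) with hrdef
  have hraise := congrArg (eval u) (shiftedJacobi_raise (lam - 1 / 2) (mu - 1 / 2) k)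
  rw [show mu - 1 / 2 + 1 = mu + 1 / 2 by ring] at hraise
  simp only [eval_mul, eval_C, eval_sub, eval_X, eval_one] at hraise
  set p := (shiftedJacobi (lam - 1 / 2) (mu + 1 / 2) k).eval u
  set P := (shiftedJacobi (lam - 1 / 2) (mu - 1 / 2) (k + 1)).eval u
  set D := (derivative (shiftedJacobi (lam - 1 / 2) (mu - 1 / 2) (k + 1))).eval u
  have h5 : |t| * (1 - u) ≤ √(u * (1 - u)) := by
    apply Real.le_sqrt_of_sq_le
    rw [mul_pow, sq_abs, ← hu]
    have := mul_nonneg hu01.1 (mul_nonneg hu01.1 (by linarith [hu01.2] : 0 ≤ 1 - u))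
    nlinarith
  have h6 : (k + 1 + (lam - 1 / 2)) * (|t| * |p|) ≤ 2 * (C₂ * R) := by
    have e1 : (k + 1 + (lam - 1 / 2)) * (|t| * |p|) = |t| * |(k + 1) * P - (u - 1) * D| := by
      rw [← hraise, abs_mul, abs_of_pos (by linarith : 0 < (k : ℝ) + 1 + (lam - 1 / 2))]
      ring
    have e2 : |(k + 1) * P - (u - 1) * D| ≤ (k + 1) * |P| + (1 - u) * |D| := by
      refine (abs_sub _ _).trans ?_
      rw [abs_mul, abs_mul, abs_of_pos (by linarith : 0 < (k : ℝ) + 1), abs_sub_comm u 1,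
        abs_of_nonneg (by linarith [hu01.2] : 0 ≤ 1 - u)]
    have e3 : |t| * ((k + 1) * |P|) ≤ C₂ * R := by
      calc |t| * ((k + 1) * |P|) ≤ 1 * ((k + 1) * (C₂ * r)) := by gcongr
        _ = C₂ * R := by rw [hR]; ring
    have e4 : |t| * ((1 - u) * |D|) ≤ C₂ * R := by
      rw [← mul_assoc]
      exact (mul_le_mul_of_nonneg_right h5 (abs_nonneg _)).trans h4
    rw [e1]
    nlinarith [mul_le_mul_of_nonneg_left e2 ht0]
  have h7 : R ≤ 2 ^ (M + 1 / 2) * (k : ℝ) ^ (M - 1 / 2) * k := by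
    have : R ≤ (2 * (k : ℝ)) ^ (M - 1 / 2 + 1) :=
      Real.rpow_le_rpow (by positivity) (by push_cast; linarith) (by linarith)
    rw [Real.mul_rpow (by norm_num) hk0.le, Real.rpow_add_one hk0.ne',
      show M - 1 / 2 + 1 = M + 1 / 2 by ring] at this
    linarith
  have h8 : |t| * |p| ≤ 4 * C₂ * 2 ^ (M + 1 / 2) * (k : ℝ) ^ (M - 1 / 2) := by
    have e1 : k / 2 * (|t| * |p|) ≤ (k + 1 + (lam - 1 / 2)) * (|t| * |p|) :=
      mul_le_mul_of_nonneg_right (by linarith) (by positivity)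
    refine le_of_mul_le_mul_left (a := (k : ℝ) / 2) ?_ (by positivity)
    calc _ ≤ 2 * (C₂ * R) := e1.trans h6
      _ ≤ 2 * (C₂ * (2 ^ (M + 1 / 2) * (k : ℝ) ^ (M - 1 / 2) * k)) := by gcongr
      _ = _ := by ring
  calc _ ≤ C₁ * (k : ℝ) ^ (1 / 2 : ℝ) * (4 * C₂ * 2 ^ (M + 1 / 2) * (k : ℝ) ^ (M - 1 / 2)) :=
        mul_le_mul h1.2 h8 (by positivity) (by positivity)
    _ = C₁ * (4 * C₂ * 2 ^ (M + 1 / 2)) * ((k : ℝ) ^ (1 / 2 : ℝ) * (k : ℝ) ^ (M - 1 / 2)) := by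
        ring
    _ = _ := by rw [← Real.rpow_add hk0]; ring_nf

theorem exists_le_uniformNorm_even {lam mu : ℝ} (hlam : -(1 / 2) < lam) (hmu : 0 < mu) :
    ∃ c : ℝ, 0 < c ∧ ∀ᶠ k : ℕ in atTop,
      c * (k : ℝ) ^ max lam mu ≤ uniformNorm (orthonormalGegenbauer lam mu (2 * k)) := by
  have hα : -1 < lam - 1 / 2 := by linarith
  have hβ : -1 < mu - 1 / 2 := by linarith
  obtain ⟨a, _, ha, _, h1⟩ := exists_gegenbauerCoeffEven_bounds hlam hmu
  rcases le_total mu lam with h | h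
  · obtain ⟨c, _, hc, _, h2⟩ := exists_pochhammerSymbol_div_factorial_bounds hα
    refine ⟨a * c, by positivity, ?_⟩
    filter_upwards [h1, h2, eventually_ge_atTop 1] with k h1 h2 hk
    have hk0 : (0 : ℝ) < k := by exact_mod_cast hk
    refine le_trans ?_ (abs_eval_le_uniformNorm _ (t := 1) (by simp))
    rw [abs_eval_orthonormalGegenbauer_even hlam hmu, one_pow, shiftedJacobi_eval_one,
      abs_of_nonneg (pochhammerSymbol_div_factorial_nonneg hα k), max_eq_left h]
    calc a * c * (k : ℝ) ^ lam = a * c * ((k : ℝ) ^ (1 / 2 : ℝ) * (k : ℝ) ^ (lam - 1 / 2)) := by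
          rw [← Real.rpow_add hk0]; ring_nf
      _ = a * (k : ℝ) ^ (1 / 2 : ℝ) * (c * (k : ℝ) ^ (lam - 1 / 2)) := by ring
      _ ≤ _ := mul_le_mul h1.1 h2.1 (by positivity) (gegenbauerCoeffEven_pos hlam hmu k).le
  · obtain ⟨c, _, hc, _, h2⟩ := exists_pochhammerSymbol_div_factorial_bounds hβ
    refine ⟨a * c, by positivity, ?_⟩
    filter_upwards [h1, h2, eventually_ge_atTop 1] with k h1 h2 hk
    have hk0 : (0 : ℝ) < k := by exact_mod_cast hk
    refine le_trans ?_ (abs_eval_le_uniformNorm _ (t := 0) (by simp))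
    rw [abs_eval_orthonormalGegenbauer_even hlam hmu, zero_pow two_ne_zero,
      abs_shiftedJacobi_eval_zero hα hβ, max_eq_right h]
    calc a * c * (k : ℝ) ^ mu = a * c * ((k : ℝ) ^ (1 / 2 : ℝ) * (k : ℝ) ^ (mu - 1 / 2)) := by
          rw [← Real.rpow_add hk0]; ring_nf
      _ = a * (k : ℝ) ^ (1 / 2 : ℝ) * (c * (k : ℝ) ^ (mu - 1 / 2)) := by ring
      _ ≤ _ := mul_le_mul h1.1 h2.1 (by positivity) (gegenbauerCoeffEven_pos hlam hmu k).le

/-- At `u = (δ/n)²` the mean value inequality allows a change of at most `C n^{β+2} · δ²/n²`, which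
small `δ` makes at most half the lower bound for `|p_n(0)|`. The hypothesis `α ≤ β` fixes the
derivative exponent at `β + 2`. -/
theorem exists_le_abs_eval_near_zero {α β : ℝ} (hα : -1 < α) (hβ : -1 < β) (h : α ≤ β) :
    ∃ δ c : ℝ, 0 < δ ∧ δ ≤ 1 ∧ 0 < c ∧ ∀ᶠ n : ℕ in atTop,
      c * (n : ℝ) ^ β ≤ |(shiftedJacobi α β n).eval ((δ / n) ^ 2)| := by
  obtain ⟨c, _, hc, _, h1⟩ := exists_pochhammerSymbol_div_factorial_bounds hβ
  obtain ⟨C, hC, h2⟩ := exists_derivative_shiftedJacobi_bound hα hβ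
  rw [max_eq_right h] at h2
  set δ := min 1 (c / (2 * C)) with hδ
  have hδ0 : 0 < δ := lt_min one_pos (by positivity)
  have hδ1 : δ ≤ 1 := min_le_left _ _
  have hδC : C * δ ^ 2 ≤ c / 2 := by
    have : C * δ ≤ c / 2 := by
      calc C * δ ≤ C * (c / (2 * C)) := by gcongr; exact min_le_right _ _
        _ = c / 2 := by field_simp
    nlinarith
  refine ⟨δ, c / 2, hδ0, hδ1, by positivity, ?_⟩
  filter_upwards [h1, h2, eventually_ge_atTop 1] with n h1 h2 hn
  have hn1 : (1 : ℝ) ≤ n := by exact_mod_cast hn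
  have hn0 : (0 : ℝ) < n := by linarith
  set u := (δ / n) ^ 2 with hu
  have hu0 : 0 ≤ u := sq_nonneg _
  have hu1 : u ≤ 1 := pow_le_one₀ (by positivity) ((div_le_one hn0).mpr (by linarith))
  have hmv := (convex_Icc (0 : ℝ) 1).norm_image_sub_le_of_norm_deriv_le
    (f := fun v => (shiftedJacobi α β n).eval v) (C := C * (n : ℝ) ^ (β + 2))
    (fun v _ => (shiftedJacobi α β n).differentiableAt)
    (fun v hv => by rw [Polynomial.deriv]; exact h2 v hv)
    (Set.left_mem_Icc.mpr zero_le_one) ⟨hu0, hu1⟩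
  simp only [Real.norm_eq_abs, sub_zero, abs_of_nonneg hu0] at hmv
  have h3 : C * (n : ℝ) ^ (β + 2) * u = C * δ ^ 2 * (n : ℝ) ^ β := by
    rw [Real.rpow_add hn0, hu, Real.rpow_two]
    field_simp
  have h4 : c * (n : ℝ) ^ β ≤ |(shiftedJacobi α β n).eval 0| := by
    rw [abs_shiftedJacobi_eval_zero hα hβ]; exact h1.1
  have h5 := abs_sub_abs_le_abs_sub ((shiftedJacobi α β n).eval 0) ((shiftedJacobi α β n).eval u)
  rw [abs_sub_comm] at h5
  have h6 : C * δ ^ 2 * (n : ℝ) ^ β ≤ c / 2 * (n : ℝ) ^ β := by gcongr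
  linarith

theorem exists_le_uniformNorm_odd {lam mu : ℝ} (hlam : -(1 / 2) < lam) (hmu : 0 < mu) :
    ∃ c : ℝ, 0 < c ∧ ∀ᶠ k : ℕ in atTop,
      c * (k : ℝ) ^ max lam mu ≤ uniformNorm (orthonormalGegenbauer lam mu (2 * k + 1)) := by
  have hα : -1 < lam - 1 / 2 := by linarith
  obtain ⟨a, _, ha, _, h1⟩ := exists_gegenbauerCoeffOdd_bounds hlam hmu
  rcases le_total mu lam with h | h
  · obtain ⟨c, _, hc, _, h2⟩ := exists_pochhammerSymbol_div_factorial_bounds hα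
    refine ⟨a * c, by positivity, ?_⟩
    filter_upwards [h1, h2, eventually_ge_atTop 1] with k h1 h2 hk
    have hk0 : (0 : ℝ) < k := by exact_mod_cast hk
    refine le_trans ?_ (abs_eval_le_uniformNorm _ (t := 1) (by simp))
    rw [abs_eval_orthonormalGegenbauer_odd hlam hmu, one_pow, shiftedJacobi_eval_one,
      abs_of_nonneg (pochhammerSymbol_div_factorial_nonneg hα k), max_eq_left h, abs_one, one_mul]
    calc a * c * (k : ℝ) ^ lam = a * c * ((k : ℝ) ^ (1 / 2 : ℝ) * (k : ℝ) ^ (lam - 1 / 2)) := by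
          rw [← Real.rpow_add hk0]; ring_nf
      _ = a * (k : ℝ) ^ (1 / 2 : ℝ) * (c * (k : ℝ) ^ (lam - 1 / 2)) := by ring
      _ ≤ _ := mul_le_mul h1.1 h2.1 (by positivity) (gegenbauerCoeffOdd_pos hlam hmu k).le
  · obtain ⟨δ, c, hδ, hδ1, hc, h2⟩ := exists_le_abs_eval_near_zero (α := lam - 1 / 2)
      (β := mu + 1 / 2) hα (by linarith) (by linarith)
    refine ⟨a * (δ * c), by positivity, ?_⟩
    filter_upwards [h1, h2, eventually_ge_atTop 1] with k h1 h2 hk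
    have hk1 : (1 : ℝ) ≤ k := by exact_mod_cast hk
    have hk0 : (0 : ℝ) < k := by linarith
    have hm : δ / k ∈ Set.Icc (-1 : ℝ) 1 :=
      ⟨by linarith [div_pos hδ hk0], (div_le_one hk0).mpr (by linarith)⟩
    refine le_trans ?_ (abs_eval_le_uniformNorm _ hm)
    rw [abs_eval_orthonormalGegenbauer_odd hlam hmu, max_eq_right h, abs_of_pos (div_pos hδ hk0)]
    -- The surplus factor `k` is cancelled by `t = δ/k`.
    have e : (k : ℝ) ^ (1 / 2 : ℝ) * (k : ℝ) ^ (mu + 1 / 2) = (k : ℝ) ^ mu * k := by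
      rw [← Real.rpow_add hk0, ← Real.rpow_add_one hk0.ne']; ring_nf
    calc a * (δ * c) * (k : ℝ) ^ mu
        = a * (δ / k * c) * ((k : ℝ) ^ (1 / 2 : ℝ) * (k : ℝ) ^ (mu + 1 / 2)) := by
          rw [e]; field_simp
      _ = a * (k : ℝ) ^ (1 / 2 : ℝ) * (δ / k * (c * (k : ℝ) ^ (mu + 1 / 2))) := by ring
      _ ≤ _ := mul_le_mul h1.1 (mul_le_mul_of_nonneg_left h2 (by positivity)) (by positivity)
          (gegenbauerCoeffOdd_pos hlam hmu k).le

theorem exists_bounds_of_even_odd {N : ℕ → ℝ} {M : ℝ} (hM : 0 ≤ M)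
    (hEl : ∃ c : ℝ, 0 < c ∧ ∀ᶠ k : ℕ in atTop, c * (k : ℝ) ^ M ≤ N (2 * k))
    (hEu : ∃ C : ℝ, 0 < C ∧ ∀ᶠ k : ℕ in atTop, N (2 * k) ≤ C * (k : ℝ) ^ M)
    (hOl : ∃ c : ℝ, 0 < c ∧ ∀ᶠ k : ℕ in atTop, c * (k : ℝ) ^ M ≤ N (2 * k + 1))
    (hOu : ∃ C : ℝ, 0 < C ∧ ∀ᶠ k : ℕ in atTop, N (2 * k + 1) ≤ C * (k : ℝ) ^ M) :
    ∃ C₁ C₂ : ℝ, ∃ n₀ : ℕ, 0 < C₁ ∧ 0 < C₂ ∧ 0 < n₀ ∧ ∀ n : ℕ, n₀ ≤ n →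
      C₁ * (n : ℝ) ^ M ≤ N n ∧ N n ≤ C₂ * (n : ℝ) ^ M := by
  obtain ⟨c₁, hc₁, h1⟩ := hEl
  obtain ⟨C₁, hC₁, h2⟩ := hEu
  obtain ⟨c₂, hc₂, h3⟩ := hOl
  obtain ⟨C₂, hC₂, h4⟩ := hOu
  obtain ⟨K, hK⟩ := eventually_atTop.mp (h1.and (h2.and (h3.and h4)))
  have h3M : (0 : ℝ) < 3 ^ M := by positivity
  have hc := lt_min hc₁ hc₂
  -- With `n = 2k` or `2k + 1` and `n ≥ 2K + 2` one has `k ≥ 1`, hence `k ≤ n ≤ 3k`.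
  refine ⟨min c₁ c₂ / 3 ^ M, max C₁ C₂, 2 * K + 2, by positivity, lt_max_of_lt_left hC₁,
    by omega, fun n hn => ?_⟩
  obtain ⟨k, hk⟩ := Nat.even_or_odd' n
  have hkK : K ≤ k := by omega
  obtain ⟨h1, h2, h3, h4⟩ := hK k hkK
  have hkn : (k : ℝ) ^ M ≤ (n : ℝ) ^ M := by
    refine Real.rpow_le_rpow (by positivity) ?_ hM
    exact_mod_cast (by omega : k ≤ n)
  have hnk : (n : ℝ) ^ M ≤ 3 ^ M * (k : ℝ) ^ M := by
    rw [← Real.mul_rpow (by norm_num) (by positivity)]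
    refine Real.rpow_le_rpow (by positivity) ?_ hM
    exact_mod_cast (by omega : n ≤ 3 * k)
  have hk0 : 0 ≤ (k : ℝ) ^ M := by positivity
  have hlow : min c₁ c₂ / 3 ^ M * (n : ℝ) ^ M ≤ min c₁ c₂ * (k : ℝ) ^ M := by
    rw [div_mul_eq_mul_div, div_le_iff₀ h3M]
    calc _ ≤ min c₁ c₂ * (3 ^ M * (k : ℝ) ^ M) := by gcongr
      _ = _ := by ring
  have hup : max C₁ C₂ * (k : ℝ) ^ M ≤ max C₁ C₂ * (n : ℝ) ^ M :=
    mul_le_mul_of_nonneg_left hkn (le_max_of_le_left hC₁.le)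
  rcases hk with rfl | rfl
  · exact ⟨hlow.trans ((mul_le_mul_of_nonneg_right (min_le_left _ _) hk0).trans h1),
      h2.trans ((mul_le_mul_of_nonneg_right (le_max_left _ _) hk0).trans hup)⟩
  · exact ⟨hlow.trans ((mul_le_mul_of_nonneg_right (min_le_right _ _) hk0).trans h3),
      h4.trans ((mul_le_mul_of_nonneg_right (le_max_right _ _) hk0).trans hup)⟩

theorem theorem1 (lam mu : ℝ) (hlam : -(1 / 2) < lam) (hmu : 0 < mu) :
    IsOrthonormalPolySeq (gegenbauerWeight lam mu) (orthonormalGegenbauer lam mu) ∧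
    ∃ C₁ C₂ : ℝ, ∃ n₀ : ℕ, 0 < C₁ ∧ 0 < C₂ ∧ 0 < n₀ ∧
      ∀ n : ℕ, n₀ ≤ n →
        C₁ * (n : ℝ) ^ max lam mu ≤ uniformNorm (orthonormalGegenbauer lam mu n) ∧
        uniformNorm (orthonormalGegenbauer lam mu n) ≤ C₂ * (n : ℝ) ^ max lam mu :=
  ⟨isOrthonormalPolySeq_orthonormalGegenbauer hlam hmu,
    exists_bounds_of_even_odd (N := fun n => uniformNorm (orthonormalGegenbauer lam mu n))
      (le_max_of_le_right hmu.le)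
      (exists_le_uniformNorm_even hlam hmu) (exists_uniformNorm_even_le hlam hmu)
      (exists_le_uniformNorm_odd hlam hmu) (exists_uniformNorm_odd_le hlam hmu)⟩
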